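/- **Conventions.** A *non-quasianalytic weight function* is a continuous increasing (i.e. non-decreasing) function $\omega:[0,\infty)\to[0,\infty)$ such that $(\alpha)$ there is $L\ge 1$ with $\omega(2t)\le L(\omega(t)+1)$ for all $t\ge 0$; $(\beta)$ $\int_1^{\infty}\frac{\omega(t)}{t^2}\,dt<\infty$; $(\gamma)$ there are $a\in\mathbb R$, $b>0$ with $\omega(t)\ge a+b\log(1+t)$ for all $t\ge 0$; $(\delta)$ $t\mapsto\omega(e^t)$ is convex on $\mathbb R$. For $x\in\mathbb R^d$ put $\omega(x):=\omega(|x|)$, with $|x|$ the Euclidean norm. For a multi-index $\alpha\in\mathbb N_0^d$ put $|\alpha|=\alpha_1+\dots+\alpha_d$ and $f^{(\alpha)}=D^\alpha f=D_1^{\alpha_1}\cdots D_d^{\alpha_d}f$, $D_j=-i\,\partial_{x_j}$. The Fourier transform is $\hat\varphi(\xi)=\int_{\mathbb R^d}\varphi(x)e^{-i\langle x,\xi\rangle}dx$ for Schwartz functions, extended to tempered distributions by $\langle\hat u,\varphi\rangle=\langle u,\hat\varphi\rangle$. For a tempered distribution $u$ put $R_u:=\sup\{|\xi|_\infty:\xi\in\operatorname{supp}u\}\in[0,+\infty]$,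 where $|\xi|_\infty=\max_j|\xi_j|$ and $R_u:=0$ if $\operatorname{supp}u=\emptyset$. **Proposition.** Let $1\le p\le+\infty$ and let $f\in C^\infty(\mathbb R^d)$ be complex-valued. (1) If $f^{(\alpha)}\in L^p(\mathbb R^d)$ for all $\alpha\in\mathbb N_0^d$, then $f$ defines a tempered distribution and $$\lim_{n\to+\infty}\Big(\max_{|\alpha|=n}\|f^{(\alpha)}\|_{L^p}\Big)^{1/n}=R_{\hat f}.$$ (2) Let $\omega$ be a non-quasianalytic weight function that satisfies one of the following conditions: (a) $\omega(t_1+t_2)\le\omega(t_1)+\omega(t_2)$ for all $t_1,t_2\ge 0$; (b) there is a constant $H>1$ with $2\omega(t)\le\omega(Ht)+H$ for all $t\ge 0$. Let $\lambda>0$ and assume that $e^{\lambda\omega\left(\frac{x}{|\alpha|+1}\right)}f^{(\alpha)}(x)\in L^p(\mathbb R^d)$ for all $\alpha\in\mathbb N_0^d$. Then $f$ defines a tempered distribution and $$\lim_{n\to+\infty}\Big(\max_{|\alpha|=n}\Big\|e^{\mu\omega\left(\frac{x}{|\alpha|+1}\right)}f^{(\alpha)}(x)\Big\|_{L^p}\Big)^{1/n}=R_{\hat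 f}\qquad\text{for all }0\le\mu\le\lambda.$$ The limits are taken in $[0,+\infty]$; in particular they are $+\infty$ when $\operatorname{supp}\hat f$ is unbounded. -/

import Mathlib

open MeasureTheory Filter Topology Distribution
open scoped ENNReal ContDiff SchwartzMap FourierTransform

noncomputable section

/-- A non-quasianalytic weight function `w : [0, ∞) → [0, ∞)`; only the values of `w` on `[0, ∞)`
matter. "Increasing" is read in the weak sense. -/
structure IsWeightFunction (w : ℝ → ℝ) : Prop where
  continuousOn : ContinuousOn w (Set.Ici 0)
  monotoneOn : MonotoneOn w (Set.Ici 0)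
  nonneg : ∀ t, 0 ≤ t → 0 ≤ w t
  /-- condition `(α)` -/
  doubling : ∃ L : ℝ, 1 ≤ L ∧ ∀ t, 0 ≤ t → w (2 * t) ≤ L * (w t + 1)
  /-- condition `(β)` -/
  integrable : IntegrableOn (fun t : ℝ => w t / t ^ 2) (Set.Ioi 1)
  /-- condition `(γ)` -/
  log_le : ∃ a b : ℝ, 0 < b ∧ ∀ t, 0 ≤ t → a + b * Real.log (1 + t) ≤ w t
  /-- condition `(δ)` -/
  convex : ConvexOn ℝ Set.univ (fun t : ℝ => w (Real.exp t))

/-- `D_j g = -i ∂g/∂x_j`. -/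
def partialD {d : ℕ} (j : Fin d) (g : EuclideanSpace ℝ (Fin d) → ℂ) :
    EuclideanSpace ℝ (Fin d) → ℂ :=
  fun x => -Complex.I * fderiv ℝ g x (EuclideanSpace.single j 1)

/-- `f^{(α)} = D_1^{α_1} ⋯ D_d^{α_d} f` for a multi-index `α`. -/
def multiD {d : ℕ} (α : Fin d → ℕ) (f : EuclideanSpace ℝ (Fin d) → ℂ) :
    EuclideanSpace ℝ (Fin d) → ℂ :=
  (List.finRange d).foldr (fun j g => (partialD j)^[α j] g) f

/-- The function `x ↦ e^{μ w(x / (|α| + 1))} f^{(α)}(x)`, where `w(x) = w(|x|)` with the Euclidean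
norm `|x|` and `|α| = α_1 + ⋯ + α_d`. -/
def weightedD {d : ℕ} (w : ℝ → ℝ) (μ : ℝ) (α : Fin d → ℕ) (f : EuclideanSpace ℝ (Fin d) → ℂ) :
    EuclideanSpace ℝ (Fin d) → ℂ :=
  fun x => (Real.exp (μ * w (‖x‖ / ((∑ i, α i : ℕ) + 1 : ℝ))) : ℂ) * multiD α f x

/-- The maximum of `a α` over the (finitely many) multi-indices `α` with `|α| = n`. -/
def maxOrder {d : ℕ} (a : (Fin d → ℕ) → ℝ≥0∞) (n : ℕ) : ℝ≥0∞ :=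
  (Finset.piAntidiag Finset.univ n).sup a

/-- The dilation `ξ ↦ (2π)⁻¹ ξ`. -/
def dilation (d : ℕ) : EuclideanSpace ℝ (Fin d) ≃L[ℝ] EuclideanSpace ℝ (Fin d) :=
  ContinuousLinearEquiv.smulLeft (Units.mk0 ((2 * Real.pi)⁻¹ : ℝ) (by positivity))

/-- The Fourier transform on Schwartz functions with the normalization
`φ̂(ξ) = ∫ φ(x) e^{-i⟨x, ξ⟩} dx`; see `fourierSchwartz_apply`. -/
def fourierSchwartz (d : ℕ) :
    𝓢(EuclideanSpace ℝ (Fin d), ℂ) →L[ℂ] 𝓢(EuclideanSpace ℝ (Fin d), ℂ) :=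
  (SchwartzMap.compCLMOfContinuousLinearEquiv ℂ (dilation d)).comp
    (FourierTransform.fourierCLM ℂ 𝓢(EuclideanSpace ℝ (Fin d), ℂ))

theorem fourierSchwartz_apply {d : ℕ} (φ : 𝓢(EuclideanSpace ℝ (Fin d), ℂ))
    (ξ : EuclideanSpace ℝ (Fin d)) :
    fourierSchwartz d φ ξ = ∫ x, φ x * Complex.exp (-Complex.I * (inner ℝ x ξ : ℝ)) := by
  have h : fourierSchwartz d φ ξ = (𝓕 (φ : EuclideanSpace ℝ (Fin d) → ℂ)) ((2 * Real.pi)⁻¹ • ξ) := by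
    rw [← SchwartzMap.fourier_coe]
    rfl
  rw [h, Real.fourier_eq']
  refine integral_congr_ae (Eventually.of_forall fun x => ?_)
  simp only [smul_eq_mul, inner_smul_right]
  rw [mul_comm]
  congr 2
  have : (Real.pi : ℂ) ≠ 0 := by exact_mod_cast Real.pi_ne_zero
  push_cast
  field_simp

/-- The Fourier transform of a tempered distribution: `⟨û, ψ⟩ = ⟨u, ψ̂⟩`. -/
def fourierTempered {d : ℕ} (u : 𝓢'(EuclideanSpace ℝ (Fin d), ℂ)) :
    𝓢'(EuclideanSpace ℝ (Fin d), ℂ) :=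
  PointwiseConvergenceCLM.precomp ℂ (fourierSchwartz d) u

/-- `u` is the tempered distribution given by the function `f`. For each `f` there is at most one
such `u`. -/
def IsDistributionOf {d : ℕ} (u : 𝓢'(EuclideanSpace ℝ (Fin d), ℂ))
    (f : EuclideanSpace ℝ (Fin d) → ℂ) : Prop :=
  ∀ ψ : 𝓢(EuclideanSpace ℝ (Fin d), ℂ),
    Integrable (fun x => f x * ψ x) ∧ u ψ = ∫ x, f x * ψ x

/-- `R_u = sup {|ξ|_∞ : ξ ∈ supp u} ∈ [0, ∞]`, with value `0` if the support is empty, where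
`|ξ|_∞ = max_j |ξ_j|`. -/
def supportRadius {d : ℕ} (u : 𝓢'(EuclideanSpace ℝ (Fin d), ℂ)) : ℝ≥0∞ :=
  ⨆ ξ ∈ dsupport u, ⨆ j : Fin d, ENNReal.ofReal |ξ j|

end

/-!
Let `R` be the radius of the spectrum of `f`, the support of its Fourier transform.

*Lower bound.* Near a point of the spectrum with `|ξ_j| > r` the multiplier `ξ_j ^ n` has the
inverse `e(ξ_j) ^ n` with a smooth function `|e| ≤ r⁻¹`. Testing `f` against a Schwartz function whose
transform lives near that point and moving `ξ_j ^ n` onto `f` shows, by Hölder's and Minkowski's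
inequalities, that `‖D_j ^ n f‖_p ≥ c r ^ n / (n + 1) ^ 2`
(`exists_le_eLpNorm_iterate_partialD`).

*Upper bound.* If `χ` is a cut-off function that is `1` on `[-r, r]`, where `R < r`, then
`D_j ^ m f` is the convolution, in the `j`-th coordinate, of `f` with the Fourier transform `k_m` of
`s ^ m χ(s)` (`iterate_partialD_ae_eq_integral_translate`). Two integrations by parts bound the mass
of `k_m` by `b ^ m`, for any given `b > r` and some large `m`
(`exists_fourierLaplace_pow_mul_le`), so every block of `m` derivatives costs a factor `b ^ m`. With
weights, the dilation parameter is increased by one for each block, since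
`|x| / (k + 1) ≤ max (|x - y| / k) |y|`: the weighted norm of the new derivative is at most `b ^ m`
times the old weighted norm, plus the *unweighted* norm times the weighted mass of `k_m`. The second
term enters only once in a product of blocks, so that `q` blocks cost `(1 + q W) b ^ (m q)`
(`le_pow_of_block_recursion`), where `W` is independent of `q`. As `m ≥ 2`, the dilation parameter
after all blocks is below `n + 1` for derivatives of large order `n`, which gives the bound
`C (n + 1) b ^ n` (`eventually_eLpNorm_weighted_le`).

The weighted mass of `k_m` is finite because of non-quasianalyticity: a finite number of moving
averages at each of the dyadic scales `2 ^ (-k)`, of finite total length because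
`∑ w(2 ^ k) / 2 ^ k < ∞`, turns any cut-off function into one whose Fourier transform is dominated
by `e ^ (-v)`, where `v = λ w` (`exists_isCutoff_weighted`). Finitely many averages dominate the
weight only after its truncation at a height `2 ^ K`; all constants are independent of `K`, and the
truncation is removed at the end by Fatou's lemma.

The `n`-th roots of both bounds converge to `R` (`tendsto_rpow_one_div_of_bounds`).
-/

/-! ### Cut-off functions and their averages -/

/-- A smooth function on the line that is `1` on `[-r, r]`, vanishes outside `(-ρ, ρ)`, and is
bounded by `A` together with its first two derivatives. -/
structure IsCutoff (χ : ℝ → ℂ) (r ρ A : ℝ) : Prop where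
  contDiff : ContDiff ℝ ∞ χ
  eq_one : ∀ s, |s| ≤ r → χ s = 1
  eq_zero : ∀ s, ρ ≤ |s| → χ s = 0
  norm_le : ∀ s, ‖χ s‖ ≤ A
  norm_deriv_le : ∀ s, ‖deriv χ s‖ ≤ A
  norm_deriv_deriv_le : ∀ s, ‖deriv (deriv χ) s‖ ≤ A

/-- The mean value of `χ` over the interval of radius `a` around `s`. -/
noncomputable def movingAverage (a : ℝ) (χ : ℝ → ℂ) (s : ℝ) : ℂ :=
  (2 * a : ℂ)⁻¹ * ∫ σ in (-a)..a, χ (s + σ)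

/-- The Fourier–Laplace transform `z ↦ ∫ χ(s) e^{2π i s z} ds`. -/
noncomputable def fourierLaplace (χ : ℝ → ℂ) (z : ℂ) : ℂ :=
  ∫ s : ℝ, χ s * Complex.exp (2 * Real.pi * Complex.I * s * z)

theorem movingAverage_eq (a : ℝ) (χ : ℝ → ℂ) (s : ℝ) :
    movingAverage a χ s = (2 * a : ℂ)⁻¹ * ∫ σ in (s - a)..(s + a), χ σ := by
  unfold movingAverage
  rw [intervalIntegral.integral_comp_add_left (fun x => χ x) s]
  rfl

theorem hasDerivAt_movingAverage {a : ℝ} {χ : ℝ → ℂ} (hχ : Continuous χ) (s : ℝ) :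
    HasDerivAt (movingAverage a χ) ((2 * a : ℂ)⁻¹ * (χ (s + a) - χ (s - a))) s := by
  have hi : ∀ x y : ℝ, IntervalIntegrable χ volume x y := fun x y => hχ.intervalIntegrable x y
  have h0 : movingAverage a χ = fun s => (2 * a : ℂ)⁻¹ *
      ((∫ σ in (0 : ℝ)..(s + a), χ σ) - ∫ σ in (0 : ℝ)..(s - a), χ σ) := by
    funext s
    rw [movingAverage_eq, intervalIntegral.integral_interval_sub_left (hi _ _) (hi _ _)]
  rw [h0]
  have hF : ∀ x : ℝ, HasDerivAt (fun u => ∫ σ in (0 : ℝ)..u, χ σ) (χ x) x := fun x =>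
    intervalIntegral.integral_hasDerivAt_right (hi _ _)
      hχ.stronglyMeasurable.stronglyMeasurableAtFilter hχ.continuousAt
  exact (((hF (s + a)).comp_add_const s a).sub ((hF (s - a)).comp_sub_const s a)).const_mul _

theorem deriv_movingAverage {a : ℝ} {χ : ℝ → ℂ} (hχ : ContDiff ℝ 1 χ) :
    deriv (movingAverage a χ) = movingAverage a (deriv χ) := by
  funext s
  rw [(hasDerivAt_movingAverage hχ.continuous s).deriv, movingAverage_eq,
    intervalIntegral.integral_deriv_eq_sub (fun x _ => hχ.differentiable (by simp) x)
      ((hχ.continuous_deriv (by simp)).intervalIntegrable _ _)]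

theorem contDiff_movingAverage {a : ℝ} {χ : ℝ → ℂ} (hχ : ContDiff ℝ ∞ χ) :
    ContDiff ℝ ∞ (movingAverage a χ) := by
  rw [contDiff_infty_iff_deriv]
  refine ⟨fun s => (hasDerivAt_movingAverage hχ.continuous s).differentiableAt, ?_⟩
  rw [funext fun s => (hasDerivAt_movingAverage (a := a) hχ.continuous s).deriv]
  fun_prop

theorem norm_movingAverage_le {a A : ℝ} (ha : 0 < a) {χ : ℝ → ℂ} (hA : ∀ s, ‖χ s‖ ≤ A) (s : ℝ) :
    ‖movingAverage a χ s‖ ≤ A := by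
  have h := intervalIntegral.norm_integral_le_of_norm_le_const (a := -a) (b := a)
    (f := fun σ => χ (s + σ)) (C := A) fun σ _ => hA _
  rw [movingAverage, norm_mul, norm_inv]
  have h2 : ‖(2 * a : ℂ)‖ = 2 * a := by
    rw [norm_mul, Complex.norm_real, Real.norm_of_nonneg ha.le]; simp
  rw [h2, inv_mul_le_iff₀ (by positivity)]
  refine h.trans_eq ?_
  rw [abs_of_pos (by linarith)]; ring

theorem movingAverage_congr {a : ℝ} {χ : ℝ → ℂ} {s : ℝ} {c : ℂ} (ha : 0 < a)
    (h : ∀ σ, |σ| ≤ a → χ (s + σ) = c) : movingAverage a χ s = c := by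
  rw [movingAverage, intervalIntegral.integral_congr (g := fun _ => c)]
  · have : (a : ℂ) ≠ 0 := by exact_mod_cast ha.ne'
    rw [intervalIntegral.integral_const, Complex.real_smul]
    push_cast
    field_simp
    ring
  · intro σ hσ
    rw [Set.uIcc_of_le (by linarith)] at hσ
    exact h σ (abs_le.2 hσ)

theorem IsCutoff.isCutoff_movingAverage {χ : ℝ → ℂ} {r ρ A : ℝ} (h : IsCutoff χ r ρ A) {a : ℝ}
    (ha : 0 < a) :
    IsCutoff (movingAverage a χ) (r - a) (ρ + a) A := by
  have h1 : ContDiff ℝ ∞ (deriv χ) := (contDiff_infty_iff_deriv.1 h.contDiff).2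
  refine ⟨contDiff_movingAverage h.contDiff,
    fun s hs => movingAverage_congr ha fun σ hσ => h.eq_one _ ?_,
    fun s hs => movingAverage_congr ha fun σ hσ => h.eq_zero _ ?_,
    norm_movingAverage_le ha h.norm_le, ?_, ?_⟩
  · linarith [abs_add_le s σ]
  · have := abs_sub_abs_le_abs_sub s (-σ)
    rw [abs_neg, sub_neg_eq_add] at this
    linarith
  · rw [deriv_movingAverage (h.contDiff.of_le (by exact_mod_cast le_top))]
    exact norm_movingAverage_le ha h.norm_deriv_le
  · rw [deriv_movingAverage (h.contDiff.of_le (by exact_mod_cast le_top)),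
      deriv_movingAverage (h1.of_le (by exact_mod_cast le_top))]
    exact norm_movingAverage_le ha h.norm_deriv_deriv_le

theorem IsCutoff.hasCompactSupport {χ : ℝ → ℂ} {r ρ A : ℝ} (h : IsCutoff χ r ρ A) :
    HasCompactSupport χ := by
  refine HasCompactSupport.intro (isCompact_Icc (a := -ρ) (b := ρ)) fun s hs => h.eq_zero s ?_
  by_contra hc
  exact hs (abs_le.1 (not_le.1 hc).le)

theorem exists_isCutoff {r ρ : ℝ} (hr : 0 < r) (hρ : r < ρ) :
    ∃ (χ : ℝ → ℂ) (A : ℝ), IsCutoff χ r ρ A := by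
  let b : ContDiffBump (0 : ℝ) := ⟨r, ρ, hr, hρ⟩
  have hs : ContDiff ℝ ∞ fun s => ((b s : ℝ) : ℂ) := Complex.ofRealCLM.contDiff.comp b.contDiff
  have hc : HasCompactSupport fun s => ((b s : ℝ) : ℂ) :=
    b.hasCompactSupport.comp_left (g := Complex.ofReal) rfl
  have hs1 := (contDiff_infty_iff_deriv.1 hs).2
  have hs2 := (contDiff_infty_iff_deriv.1 hs1).2
  obtain ⟨A0, hA0⟩ := hc.exists_bound_of_continuous hs.continuous
  obtain ⟨A1, hA1⟩ := hc.deriv.exists_bound_of_continuous hs1.continuous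
  obtain ⟨A2, hA2⟩ := hc.deriv.deriv.exists_bound_of_continuous hs2.continuous
  refine ⟨fun s => ((b s : ℝ) : ℂ), max A0 (max A1 A2), hs, fun s h => ?_, fun s h => ?_,
    fun s => (hA0 s).trans (le_max_left _ _),
    fun s => (hA1 s).trans ((le_max_left _ _).trans (le_max_right _ _)),
    fun s => (hA2 s).trans ((le_max_right _ _).trans (le_max_right _ _))⟩
  · rw [b.one_of_mem_closedBall (by simpa [b] using h), Complex.ofReal_one]
  · rw [b.zero_of_le_dist (by simpa [b] using h), Complex.ofReal_zero]

/-! ### The Fourier–Laplace transform -/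

theorem norm_cexp_two_pi_I_mul (s : ℝ) (z : ℂ) :
    ‖Complex.exp (2 * Real.pi * Complex.I * s * z)‖ = Real.exp (-(2 * Real.pi * s * z.im)) := by
  rw [Complex.norm_exp]
  congr 1
  simp

theorem norm_cexp_two_pi_I_mul_le (s : ℝ) (z : ℂ) :
    ‖Complex.exp (2 * Real.pi * Complex.I * s * z)‖ ≤ Real.exp (2 * Real.pi * |s| * |z.im|) := by
  rw [norm_cexp_two_pi_I_mul]
  refine Real.exp_le_exp.2 ?_
  have h := neg_abs_le (s * z.im)
  rw [abs_mul] at h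
  have := Real.pi_pos
  nlinarith

theorem integrable_fourierLaplace {χ : ℝ → ℂ} (hχ : Continuous χ) (hc : HasCompactSupport χ)
    (z : ℂ) : Integrable fun s : ℝ => χ s * Complex.exp (2 * Real.pi * Complex.I * s * z) :=
  (by fun_prop : Continuous _).integrable_of_hasCompactSupport hc.mul_right

theorem hasDerivAt_fourierLaplace {χ : ℝ → ℂ} (hχ : Continuous χ) (hc : HasCompactSupport χ)
    (z : ℂ) : HasDerivAt (fourierLaplace χ)
      (2 * Real.pi * Complex.I * fourierLaplace (fun s => s * χ s) z) z := by
  have key := hasDerivAt_integral_of_dominated_loc_of_deriv_le (μ := volume) (𝕜 := ℂ)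
    (F := fun (w : ℂ) (s : ℝ) => χ s * Complex.exp (2 * Real.pi * Complex.I * s * w))
    (F' := fun (w : ℂ) (s : ℝ) => χ s * (Complex.exp (2 * Real.pi * Complex.I * s * w) *
      (2 * Real.pi * Complex.I * s)))
    (x₀ := z) (s := Metric.ball z 1)
    (bound := fun s => ‖χ s‖ * (Real.exp (2 * Real.pi * |s| * (‖z‖ + 1)) * (2 * Real.pi * |s|)))
    (Metric.ball_mem_nhds z one_pos)
    (Eventually.of_forall fun w => (by fun_prop : Continuous _).aestronglyMeasurable)
    (integrable_fourierLaplace hχ hc z) (by fun_prop : Continuous _).aestronglyMeasurable ?_ ?_ ?_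
  · have h2 := key.2
    refine (h2.congr_deriv ?_ : HasDerivAt (fourierLaplace χ) _ z)
    rw [fourierLaplace, ← integral_const_mul]
    congr 1; funext s; ring
  · refine Eventually.of_forall fun s w hw => ?_
    rw [norm_mul, norm_mul]
    have h1 : ‖(2 * Real.pi * Complex.I * s : ℂ)‖ = 2 * Real.pi * |s| := by
      simp [abs_of_pos Real.pi_pos]
    rw [h1]
    gcongr
    refine (norm_cexp_two_pi_I_mul_le s w).trans (Real.exp_le_exp.2 ?_)
    have : |w.im| ≤ ‖z‖ + 1 := by
      refine (Complex.abs_im_le_norm w).trans ?_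
      have := norm_sub_norm_le w z
      rw [Metric.mem_ball, dist_eq_norm] at hw
      linarith
    have := Real.pi_pos
    gcongr
  · exact (by fun_prop : Continuous _).integrable_of_hasCompactSupport hc.norm.mul_right
  · refine Eventually.of_forall fun s w _ => ?_
    have : HasDerivAt (fun w : ℂ => 2 * Real.pi * Complex.I * s * w) (2 * Real.pi * Complex.I * s) w := by
      simpa using (hasDerivAt_id w).const_mul (2 * Real.pi * Complex.I * s : ℂ)
    exact this.cexp.const_mul _

theorem continuous_fourierLaplace_ofReal {χ : ℝ → ℂ} (hχ : Continuous χ)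
    (hc : HasCompactSupport χ) : Continuous fun t : ℝ => fourierLaplace χ t := by
  have : Continuous (fourierLaplace χ) := continuous_iff_continuousAt.2 fun z =>
    (hasDerivAt_fourierLaplace hχ hc z).continuousAt
  exact this.comp Complex.continuous_ofReal

/-- Multiplication by `s ^ m` amounts to `m` derivatives of the Fourier–Laplace transform, which
Cauchy's estimate on discs of radius `1` bounds by the values within distance `m`. -/
theorem norm_fourierLaplace_pow_mul_le {χ : ℝ → ℂ} (hχ : Continuous χ) (hc : HasCompactSupport χ)
    (m : ℕ) {z : ℂ} {C : ℝ} (h : ∀ w : ℂ, ‖w - z‖ ≤ m → ‖fourierLaplace χ w‖ ≤ C) :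
    ‖fourierLaplace (fun s => (s : ℂ) ^ m * χ s) z‖ ≤ C := by
  induction m generalizing z with
  | zero => simpa using h z (by simp)
  | succ m ih =>
    have hχm : Continuous fun s : ℝ => (s : ℂ) ^ m * χ s := by fun_prop
    have hcm : HasCompactSupport fun s : ℝ => (s : ℂ) ^ m * χ s := hc.mul_left
    have hd := hasDerivAt_fourierLaplace hχm hcm
    have hb : ∀ w ∈ Metric.sphere z 1, ‖fourierLaplace (fun s => (s : ℂ) ^ m * χ s) w‖ ≤ C := by
      intro w hw
      refine ih fun y hy => h y ?_
      rw [mem_sphere_iff_norm] at hw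
      have := norm_sub_le_norm_sub_add_norm_sub y w z
      push_cast
      linarith
    have hC := Complex.norm_deriv_le_of_forall_mem_sphere_norm_le one_pos
      (Differentiable.diffContOnCl fun w => (hd w).differentiableAt) hb
    rw [(hd z).deriv, div_one, norm_mul] at hC
    have e : (fun s : ℝ => (s : ℂ) * ((s : ℂ) ^ m * χ s)) = fun s : ℝ => (s : ℂ) ^ (m + 1) * χ s := by
      funext s; ring
    rw [e] at hC
    have h1 : ‖(2 * Real.pi * Complex.I : ℂ)‖ = 2 * Real.pi := by simp [abs_of_pos Real.pi_pos]
    rw [h1] at hC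
    have := Real.pi_gt_three
    nlinarith [norm_nonneg (fourierLaplace (fun s : ℝ => (s : ℂ) ^ (m + 1) * χ s) z)]

/-- The Fourier–Laplace transform of the uniform distribution on `[-a, a]`. -/
noncomputable def uniformFactor (a : ℝ) (z : ℂ) : ℂ :=
  (2 * a : ℂ)⁻¹ * ∫ σ in (-a)..a, Complex.exp (-(2 * Real.pi * Complex.I * z) * σ)

theorem fourierLaplace_movingAverage {a : ℝ} (ha : 0 < a) {χ : ℝ → ℂ} (hχ : Continuous χ)
    (hc : HasCompactSupport χ) (z : ℂ) :
    fourierLaplace (movingAverage a χ) z = uniformFactor a z * fourierLaplace χ z := by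
  have hsh : ∀ σ : ℝ, ∫ s : ℝ, χ (s + σ) * Complex.exp (2 * Real.pi * Complex.I * s * z) =
      Complex.exp (-(2 * Real.pi * Complex.I * z) * σ) * fourierLaplace χ z := by
    intro σ
    rw [fourierLaplace, ← integral_const_mul,
      ← integral_add_right_eq_self (fun s : ℝ => Complex.exp (-(2 * Real.pi * Complex.I * z) * σ) *
        (χ s * Complex.exp (2 * Real.pi * Complex.I * s * z))) σ]
    congr 1; funext s
    rw [mul_left_comm, ← Complex.exp_add]
    congr 2
    push_cast; ring
  have hint : Integrable (fun q : ℝ × ℝ => χ (q.1 + q.2) *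
      Complex.exp (2 * Real.pi * Complex.I * q.1 * z))
      (volume.prod (volume.restrict (Set.Ioc (-a) a))) := by
    obtain ⟨T, hT⟩ : ∃ T : ℝ, ∀ s, T < |s| → χ s = 0 := by
      obtain ⟨T, hT⟩ := hc.isCompact.isBounded.subset_closedBall (0 : ℝ)
      refine ⟨T, fun s hs => image_eq_zero_of_notMem_tsupport fun hm => ?_⟩
      have := hT hm
      rw [mem_closedBall_zero_iff, Real.norm_eq_abs] at this
      linarith
    have hcont : Continuous fun q : ℝ × ℝ => χ (q.1 + q.2) *
      Complex.exp (2 * Real.pi * Complex.I * q.1 * z) := by fun_prop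
    have h1 : IntegrableOn (fun q : ℝ × ℝ => χ (q.1 + q.2) *
      Complex.exp (2 * Real.pi * Complex.I * q.1 * z)) (Set.Icc (-(T + a)) (T + a) ×ˢ Set.Icc (-a) a)
        (volume.prod volume) :=
      hcont.continuousOn.integrableOn_compact (isCompact_Icc.prod isCompact_Icc)
    have h2 : IntegrableOn (fun q : ℝ × ℝ => χ (q.1 + q.2) *
      Complex.exp (2 * Real.pi * Complex.I * q.1 * z)) (Set.univ ×ˢ Set.Ioc (-a) a)
        (volume.prod volume) := by
      refine (h1.of_forall_sdiff_eq_zero (MeasurableSet.univ.prod measurableSet_Ioc) ?_)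
      rintro ⟨s, σ⟩ ⟨⟨-, hσ⟩, hn⟩
      have hs : T < |s + σ| := by
        by_contra hcon
        refine hn ⟨?_, Set.Ioc_subset_Icc_self hσ⟩
        have h3 := abs_le.1 (not_lt.1 hcon)
        exact ⟨by linarith [hσ.2, h3.1], by linarith [hσ.1, h3.2]⟩
      simp [hT _ hs]
    rw [IntegrableOn, ← Measure.prod_restrict, Measure.restrict_univ] at h2
    exact h2
  have hle : -a ≤ a := by linarith
  calc fourierLaplace (movingAverage a χ) z
      = (2 * a : ℂ)⁻¹ * ∫ s : ℝ, ∫ σ in Set.Ioc (-a) a, χ (s + σ) *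
          Complex.exp (2 * Real.pi * Complex.I * s * z) := by
        rw [fourierLaplace, ← integral_const_mul]
        congr 1; funext s
        rw [movingAverage, intervalIntegral.integral_of_le hle, integral_mul_const, mul_assoc]
    _ = (2 * a : ℂ)⁻¹ * ∫ σ in Set.Ioc (-a) a, ∫ s : ℝ, χ (s + σ) *
          Complex.exp (2 * Real.pi * Complex.I * s * z) := by
        rw [integral_integral_swap hint]
    _ = uniformFactor a z * fourierLaplace χ z := by
        rw [integral_congr_ae (Eventually.of_forall hsh)]
        rw [integral_mul_const, uniformFactor, intervalIntegral.integral_of_le hle]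
        exact (mul_assoc _ _ _).symm

theorem norm_uniformFactor_le {a : ℝ} (ha : 0 < a) (z : ℂ) :
    ‖uniformFactor a z‖ ≤ Real.exp (2 * Real.pi * a * |z.im|) := by
  have h2 : ‖(2 * a : ℂ)‖ = 2 * a := by
    rw [norm_mul, Complex.norm_real, Real.norm_of_nonneg ha.le]; simp
  rw [uniformFactor, norm_mul, norm_inv, h2, inv_mul_le_iff₀ (by positivity)]
  refine (intervalIntegral.norm_integral_le_of_norm_le_const (a := -a) (b := a)
    (C := Real.exp (2 * Real.pi * a * |z.im|)) fun σ hσ => ?_).trans_eq ?_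
  · have e : -(2 * Real.pi * Complex.I * z) * σ = 2 * Real.pi * Complex.I * σ * (-z) := by ring
    rw [e]
    refine (norm_cexp_two_pi_I_mul_le σ (-z)).trans (Real.exp_le_exp.2 ?_)
    rw [Set.uIoc_of_le (by linarith)] at hσ
    have := abs_le.2 (Set.Ioc_subset_Icc_self hσ)
    rw [Complex.neg_im, abs_neg]
    have := Real.pi_pos
    gcongr
  · rw [sub_neg_eq_add, abs_of_pos (by positivity : 0 < a + a)]; ring

theorem norm_uniformFactor_mul_le {a : ℝ} (ha : 0 < a) (z : ℂ) :
    ‖uniformFactor a z‖ * (2 * Real.pi * a * ‖z‖) ≤ Real.exp (2 * Real.pi * a * |z.im|) := by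
  rcases eq_or_ne z 0 with rfl | hz
  · simp
  have hp := Real.pi_pos
  set c : ℂ := -(2 * Real.pi * Complex.I * z) with hc
  have hc0 : c ≠ 0 := by
    rw [hc]; simp [hz, hp.ne']
  have hcn : ‖c‖ = 2 * Real.pi * ‖z‖ := by
    rw [hc]; simp [abs_of_pos hp]
  have hb : ∀ σ : ℝ, |σ| = a → ‖Complex.exp (c * σ)‖ ≤ Real.exp (2 * Real.pi * a * |z.im|) := by
    intro σ hσ
    have e : c * σ = 2 * Real.pi * Complex.I * σ * (-z) := by rw [hc]; ring
    rw [e]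
    refine (norm_cexp_two_pi_I_mul_le σ (-z)).trans_eq ?_
    rw [hσ, Complex.neg_im, abs_neg]
  have h2 : ‖(2 * a : ℂ)‖ = 2 * a := by
    rw [norm_mul, Complex.norm_real, Real.norm_of_nonneg ha.le]; simp
  rw [uniformFactor, integral_exp_mul_complex hc0, norm_mul, norm_inv, norm_div, h2, hcn]
  have hz' : 0 < ‖z‖ := norm_pos_iff.2 hz
  have hn := norm_sub_le (Complex.exp (c * a)) (Complex.exp (c * (-a : ℝ)))
  have h3 := hb a (abs_of_pos ha)
  have h4 := hb (-a) (by rw [abs_neg, abs_of_pos ha])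
  have e : (2 * a)⁻¹ * (‖Complex.exp (c * a) - Complex.exp (c * (-a : ℝ))‖ / (2 * Real.pi * ‖z‖)) *
      (2 * Real.pi * a * ‖z‖) = ‖Complex.exp (c * a) - Complex.exp (c * (-a : ℝ))‖ / 2 := by
    field_simp
  rw [e]
  linarith

/-! ### Cut-off functions with rapidly decaying Fourier transform -/

theorem IsCutoff.mono {χ : ℝ → ℂ} {r ρ A r' ρ' : ℝ} (h : IsCutoff χ r ρ A) (hr : r' ≤ r)
    (hρ : ρ ≤ ρ') : IsCutoff χ r' ρ' A :=
  ⟨h.contDiff, fun s hs => h.eq_one s (hs.trans hr), fun s hs => h.eq_zero s (hρ.trans hs),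
    h.norm_le, h.norm_deriv_le, h.norm_deriv_deriv_le⟩

theorem IsCutoff.iterate_movingAverage {χ : ℝ → ℂ} {r ρ A : ℝ} (h : IsCutoff χ r ρ A) {a : ℝ}
    (ha : 0 < a) (n : ℕ) :
    IsCutoff ((movingAverage a)^[n] χ) (r - n * a) (ρ + n * a) A ∧
      ∀ z, fourierLaplace ((movingAverage a)^[n] χ) z =
        uniformFactor a z ^ n * fourierLaplace χ z := by
  induction n with
  | zero => simpa using h
  | succ n ih =>
    rw [Function.iterate_succ_apply']
    refine ⟨(ih.1.isCutoff_movingAverage ha).mono (by push_cast; linarith) (by push_cast; linarith),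
      fun z => ?_⟩
    rw [fourierLaplace_movingAverage ha ih.1.contDiff.continuous ih.1.hasCompactSupport, ih.2 z, pow_succ]
    ring

theorem IsCutoff.norm_fourierLaplace_le {χ : ℝ → ℂ} {r ρ A : ℝ} (h : IsCutoff χ r ρ A)
    (hρ : 0 ≤ ρ) (z : ℂ) :
    ‖fourierLaplace χ z‖ ≤ A * Real.exp (2 * Real.pi * ρ * |z.im|) * (2 * ρ) := by
  have hp := Real.pi_pos
  have hA : 0 ≤ A := (norm_nonneg _).trans (h.norm_le 0)
  have h1 : fourierLaplace χ z = ∫ s in Set.Icc (-ρ) ρ,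
      χ s * Complex.exp (2 * Real.pi * Complex.I * s * z) := by
    rw [fourierLaplace, setIntegral_eq_integral_of_forall_compl_eq_zero]
    intro s hs
    rw [h.eq_zero s, zero_mul]
    by_contra hc
    exact hs (abs_le.1 (not_le.1 hc).le)
  rw [h1]
  refine (norm_setIntegral_le_of_norm_le_const (C := A * Real.exp (2 * Real.pi * ρ * |z.im|))
    (by simp) fun s hs => ?_).trans_eq ?_
  · rw [norm_mul]
    refine mul_le_mul (h.norm_le s) ((norm_cexp_two_pi_I_mul_le s z).trans ?_) (norm_nonneg _) hA
    have := abs_le.2 hs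
    gcongr
  · rw [Measure.real, Real.volume_Icc, ENNReal.toReal_ofReal (by linarith)]
    ring

/-- Averaging a cut-off function over intervals of finite total length `σ` keeps it a cut-off
function. Its Fourier–Laplace transform gains a factor `e ^ (-q)` at distance `2 ^ k` for each `k`
in the list of scales, if it is averaged `⌈q⌉` times at radius about `2 ^ (-k)`. -/
theorem IsCutoff.exists_multiscale_average {χ : ℝ → ℂ} {r ρ A : ℝ} (h : IsCutoff χ r ρ A)
    (q : ℕ → ℝ) (hq : ∀ k, 0 ≤ q k) {k₀ J : ℕ} {σ : ℝ}
    (hσ : ∑ i ∈ Finset.range J, (q (k₀ + i) + 1) / 2 ^ (k₀ + i) ≤ σ) :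
    ∃ χ' : ℝ → ℂ, IsCutoff χ' (r - σ) (ρ + σ) A ∧
      (∀ z, ‖fourierLaplace χ' z‖ ≤ Real.exp (2 * Real.pi * σ * |z.im|) * ‖fourierLaplace χ z‖) ∧
      ∀ z, ∀ i < J, 2 ^ (k₀ + i) ≤ ‖z‖ → ‖fourierLaplace χ' z‖ ≤
        Real.exp (2 * Real.pi * σ * |z.im|) * Real.exp (-q (k₀ + i)) * ‖fourierLaplace χ z‖ := by
  have hp := Real.pi_pos
  have hpow : ∀ k : ℕ, (0 : ℝ) < 2 ^ k := fun k => by positivity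
  induction J generalizing σ with
  | zero =>
    rw [Finset.range_zero, Finset.sum_empty] at hσ
    refine ⟨χ, h.mono (by linarith) (by linarith), fun z => ?_, fun z i hi => absurd hi (by simp)⟩
    refine le_mul_of_one_le_left (norm_nonneg _) (Real.one_le_exp (by positivity))
  | succ J ih =>
    obtain ⟨χ', h', hb, hd⟩ := ih le_rfl
    set S := ∑ i ∈ Finset.range J, (q (k₀ + i) + 1) / 2 ^ (k₀ + i) with hS
    rw [Finset.sum_range_succ, ← hS] at hσ
    set k := k₀ + J with hk
    set a : ℝ := Real.exp 1 / (2 * Real.pi * 2 ^ k) with ha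
    have ha0 : 0 < a := by positivity
    have haz : ∀ z : ℂ, 2 ^ k ≤ ‖z‖ → Real.exp 1 ≤ 2 * Real.pi * a * ‖z‖ := by
      intro z hz
      calc Real.exp 1 = 2 * Real.pi * a * 2 ^ k := by rw [ha]; field_simp
        _ ≤ _ := by gcongr
    have hale : a ≤ 1 / 2 ^ k := by
      rw [ha, div_le_div_iff₀ (by positivity) (hpow k)]
      have h1 := Real.exp_one_lt_d9
      have h2 := Real.pi_gt_three
      have : Real.exp 1 ≤ 2 * Real.pi := by linarith
      nlinarith [hpow k]
    set n := ⌈q k⌉₊ with hn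
    have hna : n * a ≤ (q k + 1) / 2 ^ k := by
      have h1 : (n : ℝ) ≤ q k + 1 := (Nat.ceil_lt_add_one (hq k)).le
      calc (n : ℝ) * a ≤ (q k + 1) * (1 / 2 ^ k) := by
            have := hq k
            gcongr
        _ = _ := by ring
    obtain ⟨hc, hF⟩ := h'.iterate_movingAverage ha0 n
    have hexp : ∀ z : ℂ, Real.exp (2 * Real.pi * a * |z.im|) ^ n *
        Real.exp (2 * Real.pi * S * |z.im|) ≤ Real.exp (2 * Real.pi * σ * |z.im|) := by
      intro z
      rw [← Real.exp_nat_mul, ← Real.exp_add]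
      refine Real.exp_le_exp.2 ?_
      have : 2 * Real.pi * |z.im| * (n * a + S) ≤ 2 * Real.pi * |z.im| * σ := by
        gcongr
        linarith
      linarith
    have hun : ∀ z, ‖uniformFactor a z‖ ^ n ≤ Real.exp (2 * Real.pi * a * |z.im|) ^ n := fun z =>
      pow_le_pow_left₀ (norm_nonneg _) (norm_uniformFactor_le ha0 z) n
    refine ⟨_, hc.mono (by linarith) (by linarith), fun z => ?_, fun z i hi hz => ?_⟩
    · rw [hF, norm_mul, norm_pow]
      calc _ ≤ Real.exp (2 * Real.pi * a * |z.im|) ^ n *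
            (Real.exp (2 * Real.pi * S * |z.im|) * ‖fourierLaplace χ z‖) :=
            mul_le_mul (hun z) (hb z) (norm_nonneg _) (by positivity)
        _ ≤ _ := by
          rw [← mul_assoc]
          exact mul_le_mul_of_nonneg_right (hexp z) (norm_nonneg _)
    · rw [hF, norm_mul, norm_pow]
      rcases Nat.lt_succ_iff_lt_or_eq.1 hi with hi | rfl
      · calc _ ≤ Real.exp (2 * Real.pi * a * |z.im|) ^ n * (Real.exp (2 * Real.pi * S * |z.im|) *
              Real.exp (-q (k₀ + i)) * ‖fourierLaplace χ z‖) :=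
              mul_le_mul (hun z) (hd z i hi hz) (norm_nonneg _) (by positivity)
          _ = (Real.exp (2 * Real.pi * a * |z.im|) ^ n * Real.exp (2 * Real.pi * S * |z.im|)) *
              (Real.exp (-q (k₀ + i)) * ‖fourierLaplace χ z‖) := by ring
          _ ≤ _ := by
            rw [mul_assoc (Real.exp (2 * Real.pi * σ * |z.im|))]
            exact mul_le_mul_of_nonneg_right (hexp z) (by positivity)
      · have h1 : ‖uniformFactor a z‖ ≤ Real.exp (2 * Real.pi * a * |z.im|) * Real.exp (-1) := by
          rw [Real.exp_neg, ← div_eq_mul_inv, le_div_iff₀ (Real.exp_pos _)]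
          exact (mul_le_mul_of_nonneg_left (haz z hz) (norm_nonneg _)).trans
            (norm_uniformFactor_mul_le ha0 z)
        have h2 : Real.exp (-1) ^ n ≤ Real.exp (-q k) := by
          rw [← Real.exp_nat_mul]
          refine Real.exp_le_exp.2 ?_
          have := Nat.le_ceil (q k)
          rw [← hn] at this
          linarith
        have h3 := pow_le_pow_left₀ (norm_nonneg _) h1 n
        rw [mul_pow] at h3
        calc _ ≤ (Real.exp (2 * Real.pi * a * |z.im|) ^ n * Real.exp (-1) ^ n) *
              (Real.exp (2 * Real.pi * S * |z.im|) * ‖fourierLaplace χ z‖) :=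
              mul_le_mul h3 (hb z) (norm_nonneg _) (by positivity)
          _ = (Real.exp (2 * Real.pi * a * |z.im|) ^ n * Real.exp (2 * Real.pi * S * |z.im|)) *
              (Real.exp (-1) ^ n * ‖fourierLaplace χ z‖) := by ring
          _ ≤ Real.exp (2 * Real.pi * σ * |z.im|) * (Real.exp (-q k) * ‖fourierLaplace χ z‖) :=
              mul_le_mul (hexp z) (mul_le_mul_of_nonneg_right h2 (norm_nonneg _))
                (by positivity) (by positivity)
          _ = _ := by ring

/-- For a weight `v` of convergent logarithmic integral there are cut-off functions of arbitrarily
narrow transition whose Fourier transform, with all its derivatives, is dominated by `e ^ (-v)` up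
to the distance `2 ^ K`, with constants that do not depend on `K`. -/
theorem exists_isCutoff_weighted {v : ℝ → ℝ} (hv : Monotone v) (hv0 : ∀ t, 0 ≤ v t)
    (hs : Summable fun k : ℕ => v (2 ^ k) / 2 ^ k) {r ρ : ℝ} (hr : 0 ≤ r) (hρ : r < ρ) :
    ∃ (A : ℝ) (W : ℕ → ℝ), ∀ K : ℕ, ∃ χ : ℝ → ℂ, IsCutoff χ r ρ A ∧ ∀ (m : ℕ) (t : ℝ),
      Real.exp (v (min (2 * Real.pi * |t|) (2 ^ K))) *
        ‖fourierLaplace (fun s => (s : ℂ) ^ m * χ s) t‖ ≤ W m * (1 + t ^ 2)⁻¹ := by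
  have hp := Real.pi_pos
  set g := (ρ - r) / 8 with hg
  have hg0 : 0 < g := by rw [hg]; linarith
  obtain ⟨χ₀, A, h₀⟩ := exists_isCutoff (r := r + 3 * g) (ρ := ρ - 3 * g) (by linarith)
    (by linarith)
  obtain ⟨hbase, hFbase⟩ := h₀.iterate_movingAverage hg0 2
  set χb := (movingAverage g)^[2] χ₀ with hχb
  have hA : 0 ≤ A := (norm_nonneg _).trans (h₀.norm_le 0)
  have hρ0 : 0 < ρ - 3 * g := by linarith
  -- the two averages at the fixed radius `g` give quadratic decay on horizontal strips
  have hB : ∀ m : ℕ, ∃ B : ℝ, 0 ≤ B ∧ ∀ w : ℂ, |w.im| ≤ m →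
      ‖fourierLaplace χb w‖ ≤ B * (1 + ‖w‖ ^ 2)⁻¹ := by
    intro m
    set E := Real.exp (2 * Real.pi * g * m) with hE
    set B₀ := A * Real.exp (2 * Real.pi * (ρ - 3 * g) * m) * (2 * (ρ - 3 * g)) with hB₀
    have hB₀0 : 0 ≤ B₀ := by positivity
    refine ⟨E ^ 2 * B₀ * (1 + ((2 * Real.pi * g) ^ 2)⁻¹), by positivity, fun w hw => ?_⟩
    have h1 : ‖fourierLaplace χ₀ w‖ ≤ B₀ := by
      refine (h₀.norm_fourierLaplace_le hρ0.le w).trans ?_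
      rw [hB₀]
      gcongr
    have hEw : Real.exp (2 * Real.pi * g * |w.im|) ≤ E := by
      rw [hE]; gcongr
    have h2 := (norm_uniformFactor_le hg0 w).trans hEw
    have h3 := (norm_uniformFactor_mul_le hg0 w).trans hEw
    have h4 := mul_le_mul (pow_le_pow_left₀ (norm_nonneg _) h2 2) h1 (norm_nonneg _)
      (by positivity)
    have h5 := mul_le_mul (pow_le_pow_left₀ (by positivity) h3 2) h1 (norm_nonneg _)
      (by positivity)
    rw [hFbase, norm_mul, norm_pow, ← div_eq_mul_inv, le_div_iff₀ (by positivity)]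
    have h6 : ‖uniformFactor g w‖ ^ 2 * ‖fourierLaplace χ₀ w‖ * ‖w‖ ^ 2 ≤
        E ^ 2 * B₀ * ((2 * Real.pi * g) ^ 2)⁻¹ := by
      rw [← div_eq_mul_inv, le_div_iff₀ (by positivity)]
      refine le_trans (le_of_eq ?_) h5
      ring
    calc _ = ‖uniformFactor g w‖ ^ 2 * ‖fourierLaplace χ₀ w‖ +
          ‖uniformFactor g w‖ ^ 2 * ‖fourierLaplace χ₀ w‖ * ‖w‖ ^ 2 := by ring
      _ ≤ _ := by rw [mul_add, mul_one]; exact add_le_add h4 h6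
  choose B hB0 hB using hB
  -- the scales are small enough in total from some `k₀` on
  set q : ℕ → ℝ := fun k => v (2 ^ (k + 5)) with hqd
  have hsum : Summable fun k : ℕ => (q k + 1) / 2 ^ k := by
    have h1 : Summable fun k : ℕ => 32 * (v (2 ^ (k + 5)) / 2 ^ (k + 5)) :=
      ((summable_nat_add_iff 5).2 hs).mul_left 32
    have h2 := h1.add summable_geometric_two
    refine h2.congr fun k => ?_
    have h3 : 32 * (v (2 ^ (k + 5)) / 2 ^ (k + 5)) = q k / 2 ^ k := by
      have h4 : (2 : ℝ) ^ (k + 5) = 32 * 2 ^ k := by ring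
      rw [hqd, mul_div_assoc', div_eq_div_iff (by positivity) (by positivity), h4]
      ring_nf
    rw [h3, add_div, one_div_pow]
  obtain ⟨k₀, hk₀⟩ : ∃ k₀ : ℕ, ∑' i, (q (i + k₀) + 1) / 2 ^ (i + k₀) < g :=
    ((tendsto_sum_nat_add fun k : ℕ => (q k + 1) / 2 ^ k).eventually_lt_const hg0).exists
  have hpart : ∀ J : ℕ, ∑ i ∈ Finset.range J, (q (k₀ + i) + 1) / 2 ^ (k₀ + i) ≤ g := by
    intro J
    refine le_trans ?_ hk₀.le
    simp_rw [add_comm k₀]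
    refine ((summable_nat_add_iff k₀).2 hsum).sum_le_tsum _ fun i _ => ?_
    have := hv0 (2 ^ (i + k₀ + 5))
    positivity
  set D : ℕ → ℝ := fun m => Real.exp (2 * Real.pi * g * m) * Real.exp (v (16 * 2 ^ k₀)) with hD
  refine ⟨A, fun m => D m * B m * (4 + Real.exp (v (16 * m)) * (1 + 4 * m ^ 2)), fun K => ?_⟩
  obtain ⟨χ, hχ, hχb, hχd⟩ := hbase.exists_multiscale_average q (fun k => hv0 _) (hpart (K + 1))
  refine ⟨χ, hχ.mono (by push_cast; linarith) (by push_cast; linarith), fun m t => ?_⟩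
  have key : ∀ w : ℂ, |w.im| ≤ m → ‖fourierLaplace χ w‖ ≤
      D m * Real.exp (-v (min (16 * ‖w‖) (2 ^ K))) * (B m * (1 + ‖w‖ ^ 2)⁻¹) := by
    intro w hw
    have hE : Real.exp (2 * Real.pi * g * |w.im|) ≤ Real.exp (2 * Real.pi * g * m) := by gcongr
    have hgoal : ∀ Q : ℝ, v (min (16 * ‖w‖) (2 ^ K)) ≤ v (16 * 2 ^ k₀) + Q →
        ‖fourierLaplace χ w‖ ≤ Real.exp (2 * Real.pi * g * |w.im|) * Real.exp (-Q) *
          ‖fourierLaplace χb w‖ → ‖fourierLaplace χ w‖ ≤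
      D m * Real.exp (-v (min (16 * ‖w‖) (2 ^ K))) * (B m * (1 + ‖w‖ ^ 2)⁻¹) := by
      intro Q hQ hle
      refine hle.trans ?_
      refine mul_le_mul ?_ (hB m w hw) (norm_nonneg _) (by positivity)
      rw [hD]
      dsimp only
      rw [mul_assoc (Real.exp (2 * Real.pi * g * m)), ← Real.exp_add (v _)]
      refine mul_le_mul hE (Real.exp_le_exp.2 (by linarith)) (by positivity) (by positivity)
    rcases le_or_gt ‖w‖ (2 ^ k₀) with hwk | hwk
    · refine hgoal 0 ?_ ?_
      · rw [add_zero]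
        refine hv ((min_le_left _ _).trans ?_)
        gcongr
      · simpa using hχb w
    · obtain ⟨i, hi1, hi2⟩ := exists_nat_pow_near (x := ‖w‖ / 2 ^ k₀) (y := (2 : ℝ))
        ((one_le_div (by positivity)).2 hwk.le) one_lt_two
      rw [le_div_iff₀ (by positivity), ← pow_add] at hi1
      rw [div_lt_iff₀ (by positivity), ← pow_add] at hi2
      have hv1 := hv0 (16 * 2 ^ k₀)
      rcases lt_or_ge i (K + 1) with hiK | hiK
      · refine hgoal _ ?_ (hχd w i hiK (by rwa [add_comm]))
        have : v (min (16 * ‖w‖) (2 ^ K)) ≤ q (k₀ + i) := by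
          refine hv ((min_le_left _ _).trans ?_)
          have e : (2 : ℝ) ^ (k₀ + i + 5) = 16 * 2 ^ (i + 1 + k₀) := by ring
          rw [e]
          gcongr
        linarith
      · refine hgoal _ ?_ (hχd w K (by omega) (le_trans (pow_le_pow_right₀ one_le_two (by omega)) hi1))
        have : v (min (16 * ‖w‖) (2 ^ K)) ≤ q (k₀ + K) := by
          refine hv ((min_le_right _ _).trans ?_)
          exact pow_le_pow_right₀ one_le_two (by omega)
        linarith
  have him : ∀ w : ℂ, ‖w - t‖ ≤ m → |w.im| ≤ m := fun w hw => by
    simpa using (Complex.abs_im_le_norm (w - t)).trans hw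
  have hcs := hχ.hasCompactSupport
  have hcon := hχ.contDiff.continuous
  have hDm : 0 ≤ D m := by positivity
  have hBm := hB0 m
  have ht1 : 0 < 1 + t ^ 2 := by positivity
  rw [← le_div_iff₀' (Real.exp_pos _), ← div_eq_mul_inv]
  refine norm_fourierLaplace_pow_mul_le hcon hcs m fun w hw => (key w (him w hw)).trans ?_
  have hwt : |t| - m ≤ ‖w‖ := by
    have h1 := norm_sub_norm_le (t : ℂ) w
    rw [norm_sub_rev, Complex.norm_real, Real.norm_eq_abs] at h1
    linarith
  rw [le_div_iff₀' (Real.exp_pos _), le_div_iff₀ ht1]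
  rcases le_or_gt (2 * (m : ℝ)) |t| with hm | hm
  · have hw2 : |t| / 2 ≤ ‖w‖ := by linarith
    have h1 : Real.exp (v (min (2 * Real.pi * |t|) (2 ^ K))) *
        Real.exp (-v (min (16 * ‖w‖) (2 ^ K))) ≤ 1 := by
      rw [← Real.exp_add, ← Real.exp_zero]
      refine Real.exp_le_exp.2 ?_
      have : v (min (2 * Real.pi * |t|) (2 ^ K)) ≤ v (min (16 * ‖w‖) (2 ^ K)) := by
        refine hv (min_le_min_right _ ?_)
        have := Real.pi_le_four
        nlinarith [abs_nonneg t]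
      linarith
    have h2 : (1 + ‖w‖ ^ 2)⁻¹ * (1 + t ^ 2) ≤ 4 := by
      rw [inv_mul_le_iff₀ (by positivity)]
      have h3 : t ^ 2 = |t| ^ 2 := (sq_abs t).symm
      nlinarith [abs_nonneg t, norm_nonneg w]
    calc _ = D m * B m * ((Real.exp (v (min (2 * Real.pi * |t|) (2 ^ K))) *
          Real.exp (-v (min (16 * ‖w‖) (2 ^ K)))) * ((1 + ‖w‖ ^ 2)⁻¹ * (1 + t ^ 2))) := by ring
      _ ≤ D m * B m * (1 * 4) := by gcongr
      _ ≤ _ := by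
        refine mul_le_mul_of_nonneg_left ?_ (by positivity)
        have : 0 ≤ Real.exp (v (16 * m)) * (1 + 4 * m ^ 2) := by positivity
        linarith
  · have h1 : Real.exp (v (min (2 * Real.pi * |t|) (2 ^ K))) ≤ Real.exp (v (16 * m)) := by
      refine Real.exp_le_exp.2 (hv ((min_le_left _ _).trans ?_))
      have := Real.pi_le_four
      nlinarith [abs_nonneg t]
    have h2 : Real.exp (-v (min (16 * ‖w‖) (2 ^ K))) ≤ 1 := by
      rw [← Real.exp_zero]
      exact Real.exp_le_exp.2 (by linarith [hv0 (min (16 * ‖w‖) (2 ^ K))])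
    have h3 : (1 + ‖w‖ ^ 2)⁻¹ ≤ 1 := inv_le_one_of_one_le₀ (by nlinarith [norm_nonneg w])
    have h4 : 1 + t ^ 2 ≤ 1 + 4 * m ^ 2 := by
      have h3 : t ^ 2 = |t| ^ 2 := (sq_abs t).symm
      nlinarith [abs_nonneg t]
    calc _ = D m * B m * (Real.exp (v (min (2 * Real.pi * |t|) (2 ^ K))) *
          Real.exp (-v (min (16 * ‖w‖) (2 ^ K))) * (1 + ‖w‖ ^ 2)⁻¹ * (1 + t ^ 2)) := by ring
      _ ≤ D m * B m * (Real.exp (v (16 * m)) * 1 * 1 * (1 + 4 * m ^ 2)) := by gcongr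
      _ ≤ _ := by
        refine mul_le_mul_of_nonneg_left ?_ (by positivity)
        linarith

/-- The logarithmic integral of an increasing function dominates its values at dyadic points. -/
theorem summable_dyadic_of_integrableOn {w : ℝ → ℝ} (hw : MonotoneOn w (Set.Ici 0))
    (hw0 : ∀ t, 0 ≤ t → 0 ≤ w t) (hi : IntegrableOn (fun t : ℝ => w t / t ^ 2) (Set.Ioi 1)) :
    Summable fun k : ℕ => w (2 ^ k) / 2 ^ k := by
  have hpow : ∀ k : ℕ, (0 : ℝ) < 2 ^ k := fun k => by positivity
  have h1 : ∀ k : ℕ, (1 : ℝ) ≤ 2 ^ k := fun k => one_le_pow₀ one_le_two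
  have hint : ∀ i j : ℕ, i ≤ j →
      IntervalIntegrable (fun t : ℝ => w t / t ^ 2) volume (2 ^ i) (2 ^ j) := by
    intro i j hij
    rw [intervalIntegrable_iff_integrableOn_Ioc_of_le (pow_le_pow_right₀ one_le_two hij)]
    exact hi.mono_set fun t ht => (h1 i).trans_lt ht.1
  refine summable_of_sum_range_le (c := 4 * ∫ t in Set.Ioi (1 : ℝ), w t / t ^ 2)
    (fun k => div_nonneg (hw0 _ (hpow k).le) (hpow k).le) fun n => ?_
  have hterm : ∀ i : ℕ, w (2 ^ i) / 2 ^ i ≤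
      4 * ∫ t in (2 ^ i : ℝ)..(2 ^ (i + 1)), w t / t ^ 2 := by
    intro i
    have hle : (2 : ℝ) ^ i ≤ 2 ^ (i + 1) := pow_le_pow_right₀ one_le_two (by omega)
    have := intervalIntegral.integral_mono_on hle (f := fun _ => w (2 ^ i) / (2 ^ (i + 1)) ^ 2)
      (by simp) (hint i (i + 1) (by omega)) fun t ht => by
        have ht0 : 0 < t := (hpow i).trans_le ht.1
        have := hw0 _ (hpow i).le
        have hm := hw (hpow i).le ht0.le ht.1
        have := ht.2
        have := hw0 t ht0.le
        gcongr
    rw [intervalIntegral.integral_const, smul_eq_mul] at this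
    calc _ = 4 * (((2 : ℝ) ^ (i + 1) - 2 ^ i) * (w (2 ^ i) / (2 ^ (i + 1)) ^ 2)) := by
          rw [pow_succ]
          field_simp
          ring
      _ ≤ _ := by linarith
  calc _ ≤ ∑ i ∈ Finset.range n, 4 * ∫ t in (2 ^ i : ℝ)..(2 ^ (i + 1)), w t / t ^ 2 :=
        Finset.sum_le_sum fun i _ => hterm i
    _ = 4 * ∫ t in Set.Ioc (1 : ℝ) (2 ^ n), w t / t ^ 2 := by
        rw [← Finset.mul_sum, intervalIntegral.sum_integral_adjacent_intervals
          (a := fun i => (2 : ℝ) ^ i) fun k _ => hint k (k + 1) (by omega), pow_zero,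
          intervalIntegral.integral_of_le (h1 n)]
    _ ≤ _ := by
        refine mul_le_mul_of_nonneg_left (setIntegral_mono_set hi ?_ ?_) (by norm_num)
        · refine (ae_restrict_iff' measurableSet_Ioi).2 (Eventually.of_forall fun t ht => ?_)
          have : (0 : ℝ) ≤ t := zero_le_one.trans (le_of_lt ht)
          exact div_nonneg (hw0 t this) (sq_nonneg t)
        · exact (Set.Ioc_subset_Ioi_self).eventuallyLE

/-! ### Integrability of the Fourier transforms of powers -/

theorem fourierLaplace_deriv {χ : ℝ → ℂ} (hχ : ContDiff ℝ 1 χ) (hc : HasCompactSupport χ) (z : ℂ) :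
    fourierLaplace (deriv χ) z = -(2 * Real.pi * Complex.I * z) * fourierLaplace χ z := by
  have hd : ∀ s : ℝ, HasDerivAt (fun s : ℝ => Complex.exp (2 * Real.pi * Complex.I * s * z))
      (Complex.exp (2 * Real.pi * Complex.I * s * z) * (2 * Real.pi * Complex.I * z)) s := by
    intro s
    have h1 : HasDerivAt (fun s : ℝ => (2 * Real.pi * Complex.I * s * z : ℂ))
        (2 * Real.pi * Complex.I * z) s := by
      simpa using ((Complex.ofRealCLM.hasDerivAt (x := s)).const_mul
        (2 * Real.pi * Complex.I : ℂ)).mul_const z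
    exact h1.cexp
  have hcont := hχ.continuous_deriv (by simp)
  have key := integral_mul_deriv_eq_deriv_mul_of_integrable
    (fun s _ => (hχ.differentiable (by simp) s).hasDerivAt) (fun s _ => hd s)
    ((by fun_prop : Continuous _).integrable_of_hasCompactSupport hc.mul_right)
    (integrable_fourierLaplace hcont hc.deriv z)
    (integrable_fourierLaplace hχ.continuous hc z)
  rw [fourierLaplace, fourierLaplace, ← neg_eq_iff_eq_neg.2 key, ← integral_neg, ← integral_const_mul]
  congr 1; funext s; ring

theorem norm_fourierLaplace_ofReal_le {χ : ℝ → ℂ} {ρ B : ℝ} (hρ : 0 ≤ ρ)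
    (h0 : ∀ s, ρ ≤ |s| → χ s = 0) (hB : ∀ s, ‖χ s‖ ≤ B) (t : ℝ) :
    ‖fourierLaplace χ t‖ ≤ 2 * ρ * B := by
  have h1 : fourierLaplace χ t = ∫ s in Set.Icc (-ρ) ρ,
      χ s * Complex.exp (2 * Real.pi * Complex.I * s * t) := by
    rw [fourierLaplace, setIntegral_eq_integral_of_forall_compl_eq_zero]
    intro s hs
    rw [h0 s, zero_mul]
    by_contra hc
    exact hs (abs_le.1 (not_le.1 hc).le)
  rw [h1]
  refine (norm_setIntegral_le_of_norm_le_const (C := B) (by simp) fun s hs => ?_).trans_eq ?_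
  · rw [norm_mul, norm_cexp_two_pi_I_mul]
    simpa using hB s
  · rw [Measure.real, Real.volume_Icc, ENNReal.toReal_ofReal (by linarith)]
    ring

theorem norm_fourierLaplace_le_inv_one_add_sq {χ : ℝ → ℂ} {ρ B : ℝ} (hρ : 0 ≤ ρ)
    (hχ : ContDiff ℝ ∞ χ) (h0 : ∀ s, ρ ≤ |s| → χ s = 0)
    (hB : ∀ s, ‖χ s‖ ≤ B) (hB2 : ∀ s, ‖deriv (deriv χ) s‖ ≤ B) (t : ℝ) :
    ‖fourierLaplace χ t‖ ≤ 4 * ρ * B * (1 + t ^ 2)⁻¹ := by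
  have hc : HasCompactSupport χ :=
    HasCompactSupport.intro (isCompact_Icc (a := -ρ) (b := ρ)) fun s hs => h0 s (by
      by_contra hc
      exact hs (abs_le.1 (not_le.1 hc).le))
  have hχ1 := (contDiff_infty_iff_deriv.1 hχ).2
  have hχ2 := (contDiff_infty_iff_deriv.1 hχ1).2
  have hz : ∀ {g : ℝ → ℂ}, Continuous (deriv g) → (∀ s, ρ ≤ |s| → g s = 0) →
      ∀ s, ρ ≤ |s| → deriv g s = 0 := by
    intro g hg hg0 s hs
    have h1 : ∀ s, ρ < |s| → deriv g s = 0 := by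
      intro s hs
      have : g =ᶠ[𝓝 s] fun _ => 0 :=
        (continuous_abs.continuousAt.eventually_const_lt hs).mono fun y hy => hg0 y hy.le
      rw [this.deriv_eq, deriv_const]
    -- the points with `ρ < |s|` are dense in those with `ρ ≤ |s|`
    have hcl : s ∈ closure {s : ℝ | ρ < |s|} := by
      rcases le_or_gt 0 s with hs0 | hs0
      · rw [abs_of_nonneg hs0] at hs
        have : s ∈ closure (Set.Ioi s) := by rw [closure_Ioi]; exact Set.self_mem_Ici
        exact closure_mono (fun y hy => hs.trans_lt ((Set.mem_Ioi.1 hy).trans_le (le_abs_self y))) this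
      · rw [abs_of_neg hs0] at hs
        have : s ∈ closure (Set.Iio s) := by rw [closure_Iio]; exact Set.self_mem_Iic
        refine closure_mono (fun y hy => ?_) this
        have h2 := neg_le_abs y
        have h3 : y < s := hy
        show ρ < |y|
        linarith
    exact (closure_minimal (s := {s : ℝ | ρ < |s|}) (fun y hy => h1 y hy)
      (isClosed_singleton.preimage hg)) hcl
  have hz2 := hz hχ2.continuous (hz hχ1.continuous h0)
  have h1 := norm_fourierLaplace_ofReal_le hρ h0 hB t
  have h2 := norm_fourierLaplace_ofReal_le hρ hz2 hB2 t
  rw [fourierLaplace_deriv (hχ1.of_le (by exact_mod_cast le_top)) hc.deriv,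
    fourierLaplace_deriv (hχ.of_le (by exact_mod_cast le_top)) hc, ← mul_assoc, norm_mul] at h2
  have h3 : ‖-(2 * Real.pi * Complex.I * t) * -(2 * Real.pi * Complex.I * t)‖ =
      (2 * Real.pi) ^ 2 * t ^ 2 := by
    rw [norm_mul, norm_neg]
    simp only [norm_mul, Complex.norm_real, Complex.norm_I, Complex.norm_ofNat, Real.norm_eq_abs,
      abs_of_pos Real.pi_pos, mul_one]
    rw [← sq_abs t]; ring
  rw [h3] at h2
  rw [← div_eq_mul_inv, le_div_iff₀ (by positivity)]
  have h4 : t ^ 2 * ‖fourierLaplace χ t‖ ≤ (2 * Real.pi) ^ 2 * t ^ 2 * ‖fourierLaplace χ t‖ := by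
    rw [mul_assoc]
    refine le_mul_of_one_le_left (by positivity) ?_
    nlinarith [Real.pi_gt_three]
  linarith

theorem deriv_deriv_pow_mul {e χ : ℝ → ℂ} (he : ContDiff ℝ ∞ e) (hχ : ContDiff ℝ ∞ χ) (n : ℕ)
    (s : ℝ) : deriv (deriv fun s => e s ^ n * χ s) s =
      n * ((n - 1 : ℕ) * e s ^ (n - 1 - 1) * deriv e s * (deriv e s * χ s) +
        e s ^ (n - 1) * (deriv (deriv e) s * χ s + deriv e s * deriv χ s)) +
      (n * e s ^ (n - 1) * deriv e s * deriv χ s + e s ^ n * deriv (deriv χ) s) := by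
  have hd : ∀ {g : ℝ → ℂ}, ContDiff ℝ ∞ g → ∀ s, HasDerivAt g (deriv g s) s := fun hg s =>
    (hg.differentiable (by simp) s).hasDerivAt
  have he1 := hd (contDiff_infty_iff_deriv.1 he).2
  have hχ1 := hd (contDiff_infty_iff_deriv.1 hχ).2
  have h1 : (deriv fun s => e s ^ n * χ s) = fun s =>
      n * (e s ^ (n - 1) * (deriv e s * χ s)) + e s ^ n * deriv χ s := by
    funext s
    refine ((((hd he s).pow n).mul (hd hχ s)).congr_deriv ?_).deriv
    simp only [Pi.pow_apply]
    ring
  rw [h1]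
  have h2 := ((((hd he s).pow (n - 1)).mul ((he1 s).mul (hd hχ s))).const_mul (n : ℂ)).add
    (((hd he s).pow n).mul (hχ1 s))
  exact h2.deriv

/-- If `|e| ≤ r` on `[-ρ, ρ]`, the Fourier transforms of `e ^ n * χ` grow no faster than `r ^ n`, up
to a polynomial factor, uniformly in the cut-off function `χ`. -/
theorem exists_fourierLaplace_pow_mul_le {e : ℝ → ℂ} (he : ContDiff ℝ ∞ e) {ρ r : ℝ} (A : ℝ)
    (hρ : 0 ≤ ρ) (hr : 0 < r) (her : ∀ s, |s| ≤ ρ → ‖e s‖ ≤ r) :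
    ∃ C : ℝ, 0 ≤ C ∧ ∀ (χ : ℝ → ℂ) (r' : ℝ), IsCutoff χ r' ρ A → ∀ (n : ℕ) (t : ℝ),
      ‖fourierLaplace (fun s => e s ^ n * χ s) t‖ ≤
        C * (n + 1) ^ 2 * r ^ n * (1 + t ^ 2)⁻¹ := by
  have he1 := (contDiff_infty_iff_deriv.1 he).2
  have he2 := (contDiff_infty_iff_deriv.1 he1).2
  obtain ⟨E₁, hE₁⟩ := (isCompact_Icc (a := -ρ) (b := ρ)).exists_bound_of_continuousOn
    he1.continuous.continuousOn
  obtain ⟨E₂, hE₂⟩ := (isCompact_Icc (a := -ρ) (b := ρ)).exists_bound_of_continuousOn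
    he2.continuous.continuousOn
  rcases lt_or_ge A 0 with hA | hA
  · refine ⟨0, le_rfl, fun χ r' h => ?_⟩
    exact absurd ((norm_nonneg _).trans (h.norm_le 0)) (by linarith)
  set E := max (max E₁ E₂) 0 with hE
  have hE0 : 0 ≤ E := le_max_right _ _
  set c := A * (E / r * (E / r) + 3 * (E / r) + 1) with hc
  have hEr : 0 ≤ E / r := by positivity
  have hc0 : 0 ≤ c := by positivity
  refine ⟨4 * ρ * c, by positivity, fun χ r' h n t => ?_⟩
  have hzero : ∀ s, ρ ≤ |s| → e s ^ n * χ s = 0 := fun s hs => by rw [h.eq_zero s hs, mul_zero]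
  have hn1 : (1 : ℝ) ≤ (n + 1) ^ 2 := by
    have : (0 : ℝ) ≤ n := n.cast_nonneg
    nlinarith
  have hsm : ContDiff ℝ ∞ fun s => e s ^ n * χ s := (he.pow n).mul h.contDiff
  have hcA : A ≤ c := by
    rw [hc]
    nlinarith [mul_nonneg hEr hEr, mul_nonneg hA (mul_nonneg hEr hEr), mul_nonneg hA hEr]
  have hb0 : ∀ s, ‖e s ^ n * χ s‖ ≤ c * (n + 1) ^ 2 * r ^ n := by
    intro s
    rcases le_or_gt ρ |s| with hs | hs
    · rw [hzero s hs, norm_zero]; positivity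
    · rw [norm_mul, norm_pow]
      calc ‖e s‖ ^ n * ‖χ s‖ ≤ r ^ n * A :=
            mul_le_mul (pow_le_pow_left₀ (norm_nonneg _) (her s hs.le) n) (h.norm_le s)
              (norm_nonneg _) (by positivity)
        _ ≤ r ^ n * (c * (n + 1) ^ 2) := by
            refine mul_le_mul_of_nonneg_left ?_ (by positivity)
            nlinarith
        _ = _ := by ring
  have hb2 : ∀ s, |s| ≤ ρ → ‖deriv (deriv fun s => e s ^ n * χ s) s‖ ≤
      c * (n + 1) ^ 2 * r ^ n := by
    intro s hs
    rw [deriv_deriv_pow_mul he h.contDiff]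
    have e1 : ‖deriv e s‖ ≤ E :=
      (hE₁ s (abs_le.1 hs)).trans ((le_max_left _ _).trans (le_max_left _ _))
    have e2 : ‖deriv (deriv e) s‖ ≤ E :=
      (hE₂ s (abs_le.1 hs)).trans ((le_max_right _ _).trans (le_max_left _ _))
    have e0 := her s hs
    have x0 := h.norm_le s
    have x1 := h.norm_deriv_le s
    have x2 := h.norm_deriv_deriv_le s
    have hk : ∀ k, ‖e s‖ ^ k ≤ r ^ k := fun k => pow_le_pow_left₀ (norm_nonneg _) e0 k
    -- `k r ^ (k - 1) = k r ^ k / r`, also for `k = 0`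
    have hpred : ∀ k : ℕ, (k : ℝ) * r ^ (k - 1) = k * r ^ k / r := by
      intro k
      rcases k with _ | k
      · simp
      · rw [Nat.add_sub_cancel, pow_succ]
        field_simp
    have hnn : (((n - 1 : ℕ) : ℝ)) ≤ n := by exact_mod_cast Nat.sub_le n 1
    have hb : ‖(n : ℂ) * ((n - 1 : ℕ) * e s ^ (n - 1 - 1) * deriv e s * (deriv e s * χ s) +
        e s ^ (n - 1) * (deriv (deriv e) s * χ s + deriv e s * deriv χ s)) +
      (n * e s ^ (n - 1) * deriv e s * deriv χ s + e s ^ n * deriv (deriv χ) s)‖ ≤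
        (n : ℝ) * ((n - 1 : ℕ) * r ^ (n - 1 - 1) * E * (E * A) +
        r ^ (n - 1) * (E * A + E * A)) + (n * r ^ (n - 1) * E * A + r ^ n * A) := by
      refine (norm_add_le _ _).trans (add_le_add ?_ ((norm_add_le _ _).trans (add_le_add ?_ ?_)))
      · rw [norm_mul, Complex.norm_natCast]
        refine mul_le_mul_of_nonneg_left ((norm_add_le _ _).trans (add_le_add ?_ ?_))
          n.cast_nonneg
        · simp only [norm_mul, norm_pow, Complex.norm_natCast]
          have := hk (n - 1 - 1)
          gcongr
        · rw [norm_mul, norm_pow]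
          refine mul_le_mul (hk _) ((norm_add_le _ _).trans ?_) (norm_nonneg _) (by positivity)
          simp only [norm_mul]
          gcongr
      · simp only [norm_mul, norm_pow, Complex.norm_natCast]
        have := hk (n - 1)
        gcongr
      · simp only [norm_mul, norm_pow]
        have := hk n
        gcongr
    refine hb.trans ?_
    have hn0 : (0 : ℝ) ≤ n := n.cast_nonneg
    have hrn : 0 < r ^ n := by positivity
    have p1 := hpred n
    have p2 := hpred (n - 1)
    have p3 : (n : ℝ) * ((n - 1 : ℕ) * r ^ (n - 1 - 1)) ≤ n * (n * r ^ n / r) / r := by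
      rw [p2]
      calc (n : ℝ) * ((n - 1 : ℕ) * r ^ (n - 1) / r) ≤ n * (n * r ^ (n - 1) / r) := by gcongr
        _ = _ := by rw [p1]; exact (mul_div_assoc _ _ _).symm
    calc _ = (n : ℝ) * ((n - 1 : ℕ) * r ^ (n - 1 - 1)) * (E * E * A) +
          3 * (n * r ^ (n - 1)) * (E * A) + r ^ n * A := by ring
      _ ≤ n * (n * r ^ n / r) / r * (E * E * A) + 3 * (n * r ^ n / r) * (E * A) + r ^ n * A := by
          rw [p1]
          gcongr
      _ = A * (n ^ 2 * (E / r * (E / r)) + n * (3 * (E / r)) + 1) * r ^ n := by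
          field_simp
      _ ≤ A * ((n + 1) ^ 2 * (E / r * (E / r)) + (n + 1) ^ 2 * (3 * (E / r)) + (n + 1) ^ 2) *
            r ^ n := by
          have : (n : ℝ) ≤ (n + 1) ^ 2 := by nlinarith
          gcongr
          linarith
      _ = _ := by rw [hc]; ring
  refine (norm_fourierLaplace_le_inv_one_add_sq hρ hsm hzero hb0 (fun s => ?_) t).trans_eq
    (by ring)
  rcases le_or_gt |s| ρ with hs | hs
  · exact hb2 s hs
  · have h1 : (fun s => e s ^ n * χ s) =ᶠ[𝓝 s] fun _ => 0 :=
      (continuous_abs.continuousAt.eventually_const_lt hs).mono fun y hy => hzero y hy.le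
    rw [h1.deriv.deriv_eq, deriv_const', deriv_const, norm_zero]
    positivity

/-! ### Tempered distributions vanish off their support -/

section support

variable {E : Type*} [NormedAddCommGroup E] [InnerProductSpace ℝ E] [FiniteDimensional ℝ E]

/-- Compactly supported functions are dense in the Schwartz space, without enlarging supports. -/
theorem exists_seq_hasCompactSupport_tendsto (φ : 𝓢(E, ℂ)) :
    ∃ ψ : ℕ → 𝓢(E, ℂ), (∀ N, HasCompactSupport (ψ N) ∧ tsupport (ψ N) ⊆ tsupport φ) ∧
      Tendsto ψ atTop (𝓝 φ) := by
  let b : ContDiffBump (0 : E) := ⟨1, 2, one_pos, one_lt_two⟩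
  set c : ℕ → ℝ := fun N => ((N : ℝ) + 1)⁻¹ with hc
  have hc0 : ∀ N, 0 < c N := fun N => by positivity
  have hc1 : ∀ N, c N ≤ 1 := fun N => inv_le_one_of_one_le₀ (by simp)
  have hb : ∀ N, ContDiff ℝ ∞ fun x : E => b (c N • x) := fun N =>
    b.contDiff.comp (contDiff_const_smul _)
  have hbc : ∀ N, HasCompactSupport fun x : E => b (c N • x) := fun N =>
    b.hasCompactSupport.comp_smul (hc0 N).ne'
  have hcs : ∀ N, HasCompactSupport fun x : E => b (c N • x) • φ x := fun N => (hbc N).smul_right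
  have hsm : ∀ N, ContDiff ℝ ∞ fun x : E => b (c N • x) • φ x := fun N => (hb N).smul (φ.smooth ⊤)
  refine ⟨fun N => (hcs N).toSchwartzMap (hsm N), fun N => ⟨hcs N, ?_⟩, ?_⟩
  · exact tsupport_smul_subset_right (fun x : E => b (c N • x)) φ
  rw [(schwartz_withSeminorms ℝ E ℂ).tendsto_nhds _ _]
  rintro ⟨k, n⟩ ε hε
  rw [SchwartzMap.schwartzSeminormFamily_apply]
  have hg : ContDiff ℝ ∞ fun x : E => b x - 1 := b.contDiff.sub contDiff_const
  -- all derivatives of the bump function minus one are bounded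
  have hC : ∀ i : ℕ, ∃ C : ℝ, 0 ≤ C ∧ ∀ x : E, ‖iteratedFDeriv ℝ i (fun x : E => b x - 1) x‖ ≤ C := by
    intro i
    have hcont : Continuous (iteratedFDeriv ℝ i fun x : E => b x - 1) :=
      hg.continuous_iteratedFDeriv (mod_cast le_top)
    obtain ⟨C, hC⟩ := (isCompact_closedBall (0 : E) 2).exists_bound_of_continuousOn hcont.continuousOn
    refine ⟨max C 1, le_max_of_le_right zero_le_one, fun x => ?_⟩
    rcases le_or_gt ‖x‖ 2 with hx | hx
    · exact (hC x (by simpa using hx)).trans (le_max_left _ _)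
    · have he : (fun x : E => b x - 1) =ᶠ[𝓝 x] fun _ => -1 :=
        (continuous_norm.continuousAt.eventually_const_lt hx).mono fun y hy => by
          have : b y = 0 := b.zero_of_le_dist (by simpa [b] using (le_of_lt hy))
          simp [this]
      rw [(he.iteratedFDeriv ℝ i).eq_of_nhds]
      refine le_trans ?_ (le_max_right _ _)
      rcases eq_or_ne i 0 with rfl | hi
      · simp
      · simp [iteratedFDeriv_const_of_ne hi]
  choose C hC0 hC using hC
  -- they vanish near the origin, so that a further power of `‖x‖` can be split off
  have hd : ∀ (N i : ℕ) (x : E), ‖iteratedFDeriv ℝ i (fun x : E => b (c N • x) - 1) x‖ ≤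
      C i * (c N * ‖x‖) := by
    intro N i x
    rcases lt_or_ge (c N * ‖x‖) 1 with hx | hx
    · have he : (fun x : E => b (c N • x) - 1) =ᶠ[𝓝 x] fun _ => 0 := by
        have : ContinuousAt (fun x : E => c N * ‖x‖) x := by fun_prop
        refine (this.eventually_lt_const hx).mono fun y hy => ?_
        have : b (c N • y) = 1 := b.one_of_mem_closedBall (by
          simpa [b, norm_smul, abs_of_pos (hc0 N)] using (le_of_lt hy))
        simp [this]
      rw [(he.iteratedFDeriv ℝ i).eq_of_nhds, show (fun _ : E => (0 : ℝ)) = 0 from rfl,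
        iteratedFDeriv_zero, Pi.zero_apply, norm_zero]
      have := hC0 i
      have := hc0 N
      positivity
    · let L : E →L[ℝ] E := c N • ContinuousLinearMap.id ℝ E
      have hL : ‖L‖ ≤ 1 := by
        refine (ContinuousLinearMap.opNorm_smul_le (c N) (ContinuousLinearMap.id ℝ E)).trans ?_
        rw [Real.norm_of_nonneg (hc0 N).le]
        exact mul_le_one₀ (hc1 N) (norm_nonneg _) ContinuousLinearMap.norm_id_le
      have e : (fun x : E => b (c N • x) - 1) = (fun x : E => b x - 1) ∘ L := rfl
      rw [e, L.iteratedFDeriv_comp_right hg x (i := i) (mod_cast le_top)]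
      refine (ContinuousMultilinearMap.norm_compContinuousLinearMap_le _ _).trans ?_
      calc _ ≤ C i * 1 := by
            refine mul_le_mul (hC i _) ?_ (by positivity) (hC0 i)
            exact Finset.prod_le_one (fun _ _ => norm_nonneg _) fun _ _ => hL
        _ ≤ _ := mul_le_mul_of_nonneg_left hx (hC0 i)
  set S := ∑ i ∈ Finset.range (n + 1), (n.choose i : ℝ) * C i *
    SchwartzMap.seminorm ℝ (k + 1) (n - i) φ with hS
  have hS0 : 0 ≤ S := Finset.sum_nonneg fun i _ =>
    mul_nonneg (mul_nonneg (Nat.cast_nonneg _) (hC0 i)) (apply_nonneg _ _)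
  have hbound : ∀ N, SchwartzMap.seminorm ℝ k n ((hcs N).toSchwartzMap (hsm N) - φ) ≤ c N * S := by
    intro N
    refine SchwartzMap.seminorm_le_bound ℝ k n _ (mul_nonneg (hc0 N).le hS0) fun x => ?_
    have e : ⇑((hcs N).toSchwartzMap (hsm N) - φ) = fun x => (b (c N • x) - 1) • φ x := by
      funext y
      rw [sub_smul, one_smul]
      rfl
    rw [e]
    have hL := norm_iteratedFDeriv_smul_le (n := n) (N := ∞) ((hb N).sub contDiff_const)
      (φ.smooth ⊤) x (mod_cast le_top) (f := fun x : E => b (c N • x) - 1)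
    refine (mul_le_mul_of_nonneg_left hL (by positivity)).trans ?_
    rw [hS, Finset.mul_sum, Finset.mul_sum]
    refine Finset.sum_le_sum fun i _ => ?_
    have h1 := φ.le_seminorm ℝ (k + 1) (n - i) x
    have h2 := hd N i x
    have := hC0 i
    have := hc0 N
    calc _ ≤ ‖x‖ ^ k * ((n.choose i : ℝ) * (C i * (c N * ‖x‖)) *
          ‖iteratedFDeriv ℝ (n - i) (⇑φ) x‖) := by gcongr
      _ = c N * ((n.choose i : ℝ) * C i * (‖x‖ ^ (k + 1) *
          ‖iteratedFDeriv ℝ (n - i) (⇑φ) x‖)) := by ring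
      _ ≤ _ := by gcongr
  have hlim : Tendsto (fun N => c N * S) atTop (𝓝 0) := by
    simpa [hc, one_div] using (tendsto_one_div_add_atTop_nhds_zero_nat (𝕜 := ℝ)).mul_const S
  filter_upwards [hlim.eventually_lt_const hε] with N hN
  exact (hbound N).trans_lt hN

theorem apply_eq_zero_of_hasCompactSupport_of_disjoint_dsupport {u : 𝓢'(E, ℂ)} {φ : 𝓢(E, ℂ)}
    (hφ : HasCompactSupport φ) (h : tsupport φ ⊆ (dsupport u)ᶜ) : u φ = 0 := by
  have hcov : ∀ x : tsupport φ, ∃ U : Set E, IsVanishingOn u U ∧ IsOpen U ∧ (x : E) ∈ U := fun x =>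
    (notMem_dsupport_iff _).1 (h x.2)
  choose U hU hUo hxU using hcov
  obtain ⟨t, ht⟩ := hφ.isCompact.elim_finite_subcover U hUo fun x hx =>
    Set.mem_iUnion.2 ⟨⟨x, hx⟩, hxU ⟨x, hx⟩⟩
  obtain ⟨g, hg, hgU, hg1⟩ : ∃ g : t → E → ℝ, (∀ i, ContDiff ℝ ∞ (g i)) ∧
      (∀ i, tsupport (g i) ⊆ U i) ∧ ∀ x ∈ tsupport φ, ∑ i, g i x = 1 := by
    obtain ⟨f, hf⟩ := SmoothPartitionOfUnity.exists_isSubordinate (modelWithCornersSelf ℝ E)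
      (isClosed_tsupport φ) (fun i : t => U i) (fun i => hUo i) (by rwa [Set.iUnion_subtype])
    refine ⟨fun i => f i, fun i => contMDiff_iff_contDiff.1 (f i).contMDiff, hf, fun x hx => ?_⟩
    rw [← finsum_eq_sum_of_fintype]
    exact f.sum_eq_one hx
  have hsm : ∀ i : t, ContDiff ℝ ∞ fun x => g i x • φ x := fun i => (hg i).smul (φ.smooth ⊤)
  have hcs : ∀ i : t, HasCompactSupport fun x => g i x • φ x := fun i =>
    hφ.smul_left (f := g i) (f' := φ)
  have hsum : φ = ∑ i : t, (hcs i).toSchwartzMap (hsm i) := by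
    ext x
    rw [sum_apply]
    change φ x = ∑ i : t, g i x • φ x
    rw [← Finset.sum_smul]
    by_cases hx : x ∈ tsupport φ
    · rw [hg1 x hx, one_smul]
    · rw [image_eq_zero_of_notMem_tsupport hx, smul_zero]
  have hz : ∀ i : t, u ((hcs i).toSchwartzMap (hsm i)) = 0 := fun i =>
    hU i _ ((tsupport_smul_subset_left (g i) φ).trans (hgU i))
  calc u φ = u (∑ i : t, (hcs i).toSchwartzMap (hsm i)) := congrArg u hsum
    _ = 0 := by
      rw [map_sum]
      exact Finset.sum_eq_zero fun i _ => hz i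

/-- A tempered distribution annihilates every Schwartz function whose support is disjoint from the
support of the distribution, compact or not. -/
theorem apply_eq_zero_of_disjoint_dsupport {u : 𝓢'(E, ℂ)} {φ : 𝓢(E, ℂ)}
    (h : tsupport φ ⊆ (dsupport u)ᶜ) : u φ = 0 := by
  obtain ⟨ψ, hψ, hlim⟩ := exists_seq_hasCompactSupport_tendsto φ
  have hz : ∀ N, u (ψ N) = 0 := fun N =>
    apply_eq_zero_of_hasCompactSupport_of_disjoint_dsupport (hψ N).1 ((hψ N).2.trans h)
  have h1 : Tendsto (fun N => u (ψ N)) atTop (𝓝 (u φ)) := (u.continuous.tendsto φ).comp hlim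
  simp_rw [hz] at h1
  exact (tendsto_nhds_unique h1 tendsto_const_nhds)

end support

/-! ### Averages of translates -/

section translates

variable {G : Type*} [AddGroup G] [MeasurableSpace G] [MeasurableAdd₂ G] [MeasurableNeg G]
  {μ : Measure G} [SFinite μ] [μ.IsAddRightInvariant]

/-- Minkowski's integral inequality for averages of translates. -/
theorem eLpNorm_lintegral_translate_le {p : ℝ≥0∞} (hp : 1 ≤ p) {F : G → ℝ≥0∞} (hF : Measurable F)
    {a : ℝ → G} (ha : Measurable a) {k : ℝ → ℝ≥0∞} (hk : Measurable k) :
    eLpNorm (fun x => ∫⁻ t, F (x - a t) * k t) p μ ≤ eLpNorm F p μ * ∫⁻ t, k t := by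
  have hm : Measurable fun q : G × ℝ => F (q.1 - a q.2) :=
    hF.comp (measurable_fst.sub (ha.comp measurable_snd))
  rcases eq_or_ne p ⊤ with rfl | hpt
  · rw [eLpNorm_exponent_top, eLpNorm_exponent_top]
    set S := eLpNormEssSup F μ with hS
    have h1 : ∀ᵐ t : ℝ, ∀ᵐ x ∂μ, F (x - a t) ≤ S := Eventually.of_forall fun t =>
      (measurePreserving_sub_right μ (a t)).quasiMeasurePreserving.ae
        (enorm_ae_le_eLpNormEssSup F μ)
    have h2 : ∀ᵐ x ∂μ, ∀ᵐ t : ℝ, F (x - a t) ≤ S := by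
      refine (Measure.ae_ae_comm ?_).1 h1
      exact measurableSet_le (hm.comp measurable_swap) measurable_const
    refine essSup_le_of_ae_le _ (h2.mono fun x hx => ?_)
    calc ‖∫⁻ t, F (x - a t) * k t‖ₑ = ∫⁻ t, F (x - a t) * k t := rfl
      _ ≤ ∫⁻ t, S * k t := lintegral_mono_ae (hx.mono fun t ht => by gcongr)
      _ = S * ∫⁻ t, k t := lintegral_const_mul _ hk
  have hp0 : p ≠ 0 := (zero_lt_one.trans_le hp).ne'
  have hp1 : 1 ≤ p.toReal := by
    rw [← ENNReal.toReal_one]; exact (ENNReal.toReal_le_toReal (by simp) hpt).2 hp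
  have hpp : 0 < p.toReal := zero_lt_one.trans_le hp1
  rw [eLpNorm_eq_lintegral_rpow_enorm_toReal hp0 hpt, eLpNorm_eq_lintegral_rpow_enorm_toReal hp0 hpt]
  set r := p.toReal with hr
  set κ := ∫⁻ t, k t with hκ
  have hsub : ∀ x, (∫⁻ t, F (x - a t) * k t) ^ r ≤ κ ^ (r - 1) * ∫⁻ t, F (x - a t) ^ r * k t := by
    intro x
    have hFx : Measurable fun t => F (x - a t) := hm.comp measurable_prodMk_left
    rcases eq_or_lt_of_le hp1 with h1 | h1
    · simp [← h1]
    have hc := Real.HolderConjugate.conjExponent h1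
    have e1 : ∫⁻ t, F (x - a t) * k t = ∫⁻ t, F (x - a t) ∂(volume.withDensity k) := by
      rw [lintegral_withDensity_eq_lintegral_mul _ hk hFx]
      simp [mul_comm]
    have e2 : ∫⁻ t, F (x - a t) ^ r * k t = ∫⁻ t, F (x - a t) ^ r ∂(volume.withDensity k) := by
      rw [lintegral_withDensity_eq_lintegral_mul _ hk (hFx.pow_const r)]
      simp [mul_comm]
    have e3 : κ = ∫⁻ _, 1 ∂(volume.withDensity k) := by simp [hκ]
    have hH := ENNReal.lintegral_mul_le_Lp_mul_Lq (volume.withDensity k) hc hFx.aemeasurable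
      (aemeasurable_const (b := (1 : ℝ≥0∞)))
    simp only [Pi.mul_apply, mul_one, ENNReal.one_rpow] at hH
    rw [← e1, ← e2, ← e3] at hH
    calc _ ≤ ((∫⁻ t, F (x - a t) ^ r * k t) ^ (1 / r) * κ ^ (1 / r.conjExponent)) ^ r := by
          gcongr
      _ = _ := by
          rw [ENNReal.mul_rpow_of_nonneg _ _ hpp.le, ← ENNReal.rpow_mul, ← ENNReal.rpow_mul,
            one_div_mul_cancel hpp.ne', ENNReal.rpow_one, mul_comm]
          congr 2
          rw [Real.conjExponent]
          field_simp
  have hmain : ∫⁻ x, (∫⁻ t, F (x - a t) * k t) ^ r ∂μ ≤ κ ^ r * ∫⁻ x, F x ^ r ∂μ := by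
    have hmm : Measurable fun q : G × ℝ => F (q.1 - a q.2) ^ r * k q.2 :=
      (hm.pow_const r).mul (hk.comp measurable_snd)
    calc _ ≤ ∫⁻ x, κ ^ (r - 1) * (∫⁻ t, F (x - a t) ^ r * k t) ∂μ := lintegral_mono hsub
      _ = κ ^ (r - 1) * ∫⁻ x, (∫⁻ t, F (x - a t) ^ r * k t) ∂μ :=
          lintegral_const_mul _ hmm.lintegral_prod_right'
      _ = κ ^ (r - 1) * ∫⁻ t, ∫⁻ x, F (x - a t) ^ r * k t ∂μ := by
          rw [lintegral_lintegral_swap hmm.aemeasurable]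
      _ = κ ^ (r - 1) * ∫⁻ t, (∫⁻ x, F x ^ r ∂μ) * k t := by
          congr 1
          refine lintegral_congr fun t => ?_
          have : Measurable fun x => F (x - a t) ^ r :=
            (hF.comp (measurable_sub_const' (a t))).pow_const r
          rw [lintegral_mul_const _ this, lintegral_sub_right_eq_self (fun x => F x ^ r) (a t)]
      _ = κ ^ (r - 1) * κ * ∫⁻ x, F x ^ r ∂μ := by
          rw [lintegral_const_mul _ hk, ← hκ]; ring
      _ = _ := by
          congr 1
          nth_rewrite 2 [← ENNReal.rpow_one κ]
          rw [← ENNReal.rpow_add_of_nonneg _ _ (by linarith) zero_le_one, sub_add_cancel]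
  calc _ ≤ (κ ^ r * ∫⁻ x, F x ^ r ∂μ) ^ (1 / r) := by
        refine ENNReal.rpow_le_rpow hmain (by positivity)
    _ = _ := by
        rw [ENNReal.mul_rpow_of_nonneg _ _ (by positivity), ← ENNReal.rpow_mul,
          mul_one_div_cancel hpp.ne', ENNReal.rpow_one, mul_comm]
        rfl

end translates

/-- Hölder's inequality for a function tested against a Schwartz function. -/
theorem lintegral_enorm_mul_le {G : Type*} [MeasurableSpace G] {μ : Measure G} {p q : ℝ≥0∞}
    [p.HolderConjugate q] {f g : G → ℂ} (hf : AEStronglyMeasurable f μ)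
    (hg : AEStronglyMeasurable g μ) :
    ∫⁻ x, ‖f x‖ₑ * ‖g x‖ₑ ∂μ ≤ eLpNorm f p μ * eLpNorm g q μ := by
  have h := eLpNorm_smul_le_mul_eLpNorm (p := p) (q := q) (r := 1) hg hf
  rw [eLpNorm_one_eq_lintegral_enorm] at h
  simpa [enorm_mul] using h

/-! ### Fourier multipliers in one coordinate -/

section multiplier

variable {d : ℕ}

local notation "V" => EuclideanSpace ℝ (Fin d)

theorem hasTemperateGrowth_coord (j : Fin d) :
    Function.HasTemperateGrowth fun ξ : V => ((ξ j : ℝ) : ℂ) :=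
  (Complex.ofRealCLM.comp (EuclideanSpace.proj (𝕜 := ℝ) j)).hasTemperateGrowth

theorem hasTemperateGrowth_comp_coord {M : ℝ → ℂ} (hM : ContDiff ℝ ∞ M) (hc : HasCompactSupport M)
    (j : Fin d) : Function.HasTemperateGrowth fun ξ : V => M (ξ j) :=
  (hc.hasTemperateGrowth hM).comp
    (EuclideanSpace.proj (𝕜 := ℝ) j).hasTemperateGrowth

theorem exists_fourierSchwartz_eq (φ : 𝓢(V, ℂ)) : ∃ ψ, fourierSchwartz d ψ = φ := by
  refine ⟨FourierTransform.fourierInv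
    (SchwartzMap.compCLMOfContinuousLinearEquiv ℂ (dilation d).symm φ), ?_⟩
  ext x
  rw [fourierSchwartz, ContinuousLinearMap.comp_apply, FourierTransform.fourierCLM_apply,
    FourierTransform.fourier_fourierInv_eq]
  simp

theorem partialD_fourierSchwartz (j : Fin d) (φ : 𝓢(V, ℂ)) (x : V) :
    partialD j (fourierSchwartz d φ) x =
      -fourierSchwartz d (SchwartzMap.smulLeftCLM ℂ (fun ξ : V => ((ξ j : ℝ) : ℂ)) φ) x := by
  set m : V := dilation d (EuclideanSpace.single j 1) with hm
  have hmul : -(2 * Real.pi * Complex.I) • SchwartzMap.smulLeftCLM ℂ (inner ℝ · m) φ =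
      -Complex.I • SchwartzMap.smulLeftCLM ℂ (fun ξ : V => ((ξ j : ℝ) : ℂ)) φ := by
    ext ξ
    have h1 : (fun ξ : V => inner ℝ ξ m).HasTemperateGrowth :=
      ((innerSL ℝ).flip m).hasTemperateGrowth
    have h2 : inner ℝ ξ m = (2 * Real.pi)⁻¹ * ξ j := by
      change inner ℝ ξ ((2 * Real.pi)⁻¹ • (EuclideanSpace.single j 1 : V)) = _
      rw [inner_smul_right, EuclideanSpace.inner_single_right]
      simp
    rw [smul_apply, smul_apply, SchwartzMap.smulLeftCLM_apply_apply h1,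
      SchwartzMap.smulLeftCLM_apply_apply (hasTemperateGrowth_coord j), h2]
    have : (Real.pi : ℂ) ≠ 0 := by exact_mod_cast Real.pi_ne_zero
    simp only [smul_eq_mul, Complex.real_smul]
    push_cast
    field_simp
  have h : fderiv ℝ (fourierSchwartz d φ) x (EuclideanSpace.single j 1) =
      FourierTransform.fourier (-Complex.I •
        SchwartzMap.smulLeftCLM ℂ (fun ξ : V => ((ξ j : ℝ) : ℂ)) φ) (dilation d x) := by
    rw [← hmul, ← SchwartzMap.lineDerivOp_fourier_eq, ← SchwartzMap.lineDerivOp_apply_eq_fderiv]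
    exact congrArg (fun ψ : 𝓢(V, ℂ) => ψ x)
      (SchwartzMap.lineDerivOp_compCLMOfContinuousLinearEquiv (𝕜 := ℂ) (EuclideanSpace.single j (1 : ℝ))
        (dilation d) (FourierTransform.fourier φ))
  rw [partialD, h, FourierTransform.fourier_smul, smul_apply, smul_eq_mul, ← mul_assoc]
  simp
  rfl

/-- A multiplier `M(ξ_j)` acts as convolution, in the `j`-th coordinate, with the Fourier transform
of `M`. The factor `2π` reflects the two normalizations of the Fourier transform. -/
theorem fourierSchwartz_smulLeftCLM_comp_coord {M : ℝ → ℂ} (hM : ContDiff ℝ ∞ M)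
    (hc : HasCompactSupport M) (hk : Integrable fun t : ℝ => fourierLaplace M t) (j : Fin d)
    (φ : 𝓢(V, ℂ)) (x : V) :
    fourierSchwartz d (SchwartzMap.smulLeftCLM ℂ (fun ξ : V => M (ξ j)) φ) x =
      ∫ t : ℝ, fourierLaplace M t *
        fourierSchwartz d φ (x + EuclideanSpace.single j (2 * Real.pi * t)) := by
  have hinv : ∀ s : ℝ, M s = ∫ t : ℝ, fourierLaplace M t *
      Complex.exp (-(2 * Real.pi * Complex.I * s * t)) := by
    intro s
    have h1 := congrArg (fun ψ : 𝓢(ℝ, ℂ) => ψ s)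
      (FourierTransform.fourier_fourierInv_eq (F := 𝓢(ℝ, ℂ)) (E := 𝓢(ℝ, ℂ)) (hc.toSchwartzMap hM))
    simp only [SchwartzMap.fourier_coe, SchwartzMap.fourierInv_coe] at h1
    rw [Real.fourier_eq'] at h1
    refine h1.symm.trans (integral_congr_ae (Eventually.of_forall fun t => ?_))
    simp only [smul_eq_mul]
    rw [Real.fourierInv_eq', mul_comm, fourierLaplace]
    congr 1
    · congr 1; funext u
      rw [smul_eq_mul, mul_comm]
      congr 2
      simp
      ring
    · congr 1
      simp
      ring
  have hcont := continuous_fourierLaplace_ofReal hM.continuous hc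
  have hint : Integrable (fun q : V × ℝ => φ q.1 * fourierLaplace M q.2 *
      (Complex.exp (-(2 * Real.pi * Complex.I * q.1 j * q.2)) *
        Complex.exp (-Complex.I * (inner ℝ q.1 x : ℝ)))) (volume.prod volume) := by
    refine (φ.integrable.mul_prod hk).mul_bdd (c := 1) (by fun_prop) ?_
    refine Eventually.of_forall fun q => ?_
    rw [← Complex.exp_add, Complex.norm_exp]
    simp
  rw [fourierSchwartz_apply]
  calc _ = ∫ ξ : V, ∫ t : ℝ, φ ξ * fourierLaplace M t *
      (Complex.exp (-(2 * Real.pi * Complex.I * ξ j * t)) *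
        Complex.exp (-Complex.I * (inner ℝ ξ x : ℝ))) := by
        congr 1; funext ξ
        rw [SchwartzMap.smulLeftCLM_apply_apply (hasTemperateGrowth_comp_coord hM hc j), smul_eq_mul,
          hinv (ξ j), ← integral_mul_const, ← integral_mul_const]
        congr 1; funext t
        ring
    _ = ∫ t : ℝ, ∫ ξ : V, φ ξ * fourierLaplace M t *
      (Complex.exp (-(2 * Real.pi * Complex.I * ξ j * t)) *
        Complex.exp (-Complex.I * (inner ℝ ξ x : ℝ))) := integral_integral_swap hint
    _ = _ := by
        congr 1; funext t
        rw [fourierSchwartz_apply, ← integral_const_mul]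
        congr 1; funext ξ
        rw [← Complex.exp_add, mul_comm (φ ξ), mul_assoc]
        congr 3
        rw [inner_add_right, EuclideanSpace.inner_single_right]
        simp
        ring

end multiplier

/-! ### Integration against Fourier transforms -/

section spectrum

variable {d : ℕ}

local notation "V" => EuclideanSpace ℝ (Fin d)

theorem integrable_mul_schwartzMap {p : ℝ≥0∞} (hp : 1 ≤ p) {h : V → ℂ} (hh : MemLp h p volume)
    (φ : 𝓢(V, ℂ)) : Integrable fun x => h x * φ x := by
  have := ENNReal.HolderConjugate.inv_one_sub_inv' hp
  exact hh.integrable_mul (φ.memLp (1 - p⁻¹)⁻¹)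

theorem contDiff_partialD (j : Fin d) {h : V → ℂ} (hh : ContDiff ℝ ∞ h) :
    ContDiff ℝ ∞ (partialD j h) :=
  contDiff_const.mul ((hh.fderiv_right (m := ∞) (by simp)).clm_apply contDiff_const)

theorem contDiff_iterate_partialD (j : Fin d) {h : V → ℂ} (hh : ContDiff ℝ ∞ h) (m : ℕ) :
    ContDiff ℝ ∞ ((partialD j)^[m] h) := by
  induction m with
  | zero => exact hh
  | succ m ih => rw [Function.iterate_succ_apply']; exact contDiff_partialD j ih

/-- Integration by parts; the boundary terms vanish since `h` and its derivative are in `L^p`. -/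
theorem integral_partialD_mul_fourierSchwartz {p : ℝ≥0∞} (hp : 1 ≤ p) (j : Fin d) {h : V → ℂ}
    (hs : ContDiff ℝ ∞ h) (hh : MemLp h p volume) (hh' : MemLp (partialD j h) p volume)
    (φ : 𝓢(V, ℂ)) :
    ∫ x, partialD j h x * fourierSchwartz d φ x =
      ∫ x, h x * fourierSchwartz d
        (SchwartzMap.smulLeftCLM ℂ (fun ξ : V => ((ξ j : ℝ) : ℂ)) φ) x := by
  set ψ := fourierSchwartz d φ with hψ
  set e : V := EuclideanSpace.single j 1 with he
  set ψ' := fourierSchwartz d (SchwartzMap.smulLeftCLM ℂ (fun ξ : V => ((ξ j : ℝ) : ℂ)) φ) with hψ'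
  have h1 : ∀ x, fderiv ℝ ψ x e = -Complex.I * ψ' x := by
    intro x
    have := partialD_fourierSchwartz j φ x
    rw [partialD] at this
    linear_combination Complex.I * this + fderiv ℝ ψ x e * Complex.I_sq
  have h2 : ∀ x, fderiv ℝ h x e = Complex.I * partialD j h x := by
    intro x
    rw [partialD]
    linear_combination fderiv ℝ h x e * Complex.I_sq
  have key := integral_mul_fderiv_eq_neg_fderiv_mul_of_integrable (μ := volume) (f := h) (g := ψ)
    (v := e) ?_ ?_ (integrable_mul_schwartzMap hp hh ψ)
    (fun x _ => hs.differentiable (by simp) x) (fun x _ => ψ.differentiableAt)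
  · simp only [h1, h2] at key
    have e1 : ∫ x, h x * (-Complex.I * ψ' x) = -Complex.I * ∫ x, h x * ψ' x := by
      rw [← integral_const_mul]; congr 1; funext x; ring
    have e2 : ∫ x, Complex.I * partialD j h x * ψ x = Complex.I * ∫ x, partialD j h x * ψ x := by
      rw [← integral_const_mul]; congr 1; funext x; ring
    rw [e1, e2, neg_mul, neg_inj] at key
    exact (mul_left_cancel₀ Complex.I_ne_zero key).symm
  · simp only [h2]
    refine ((integrable_mul_schwartzMap hp hh' ψ).const_mul Complex.I).congr
      (Eventually.of_forall fun x => ?_)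
    ring
  · simp only [h1]
    refine ((integrable_mul_schwartzMap hp hh ψ').const_mul (-Complex.I)).congr
      (Eventually.of_forall fun x => ?_)
    ring

theorem hasTemperateGrowth_coord_pow (j : Fin d) (m : ℕ) :
    Function.HasTemperateGrowth fun ξ : V => ((ξ j : ℝ) : ℂ) ^ m :=
  (hasTemperateGrowth_coord j).pow m

theorem integral_iterate_partialD_mul_fourierSchwartz {p : ℝ≥0∞} (hp : 1 ≤ p) (j : Fin d)
    {h : V → ℂ} (hs : ContDiff ℝ ∞ h) {m : ℕ}
    (hh : ∀ k ≤ m, MemLp ((partialD j)^[k] h) p volume) (φ : 𝓢(V, ℂ)) :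
    ∫ x, (partialD j)^[m] h x * fourierSchwartz d φ x =
      ∫ x, h x * fourierSchwartz d
        (SchwartzMap.smulLeftCLM ℂ (fun ξ : V => ((ξ j : ℝ) : ℂ) ^ m) φ) x := by
  induction m generalizing φ with
  | zero => simp
  | succ m ih =>
    have h1 := integral_partialD_mul_fourierSchwartz hp j (contDiff_iterate_partialD j hs m)
      (hh m (by omega)) (by rw [← Function.iterate_succ_apply' (partialD j)]; exact hh _ le_rfl) φ
    rw [Function.iterate_succ_apply', h1, ih (fun k hk => hh k (by omega))]
    congr! 5
    ext ξ
    rw [SchwartzMap.smulLeftCLM_apply_apply (hasTemperateGrowth_coord_pow j m),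
      SchwartzMap.smulLeftCLM_apply_apply (hasTemperateGrowth_coord j),
      SchwartzMap.smulLeftCLM_apply_apply (hasTemperateGrowth_coord_pow j (m + 1)), smul_smul,
      pow_succ]

/-- The Fourier transform of `h`, as a tempered distribution, annihilates all test functions that
vanish on the slab `|ξ_j| < r`. -/
def SpectrumIn (j : Fin d) (r : ℝ) (h : V → ℂ) : Prop :=
  ∀ φ : 𝓢(V, ℂ), (∀ ξ, |ξ j| < r → φ ξ = 0) → ∫ x, h x * fourierSchwartz d φ x = 0

theorem SpectrumIn.partialD {p : ℝ≥0∞} (hp : 1 ≤ p) {i j : Fin d} {r : ℝ} {h : V → ℂ}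
    (hr : SpectrumIn j r h) (hs : ContDiff ℝ ∞ h) (hh : MemLp h p volume)
    (hh' : MemLp (partialD i h) p volume) : SpectrumIn j r (partialD i h) := by
  intro φ hφ
  rw [integral_partialD_mul_fourierSchwartz hp i hs hh hh']
  refine hr _ fun ξ hξ => ?_
  rw [SchwartzMap.smulLeftCLM_apply_apply (hasTemperateGrowth_coord i), hφ ξ hξ, smul_zero]

/-- The slab is open, so a test function that vanishes on it has its support off the spectrum. -/
theorem spectrumIn_of_supportRadius_lt {u : 𝓢'(V, ℂ)} {f : V → ℂ} (hu : IsDistributionOf u f)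
    {r : ℝ} (hr : supportRadius (fourierTempered u) < ENNReal.ofReal r) (j : Fin d) :
    SpectrumIn j r f := by
  intro φ hφ
  rw [← (hu _).2]
  change fourierTempered u φ = 0
  refine apply_eq_zero_of_disjoint_dsupport fun ξ hξ hmem => ?_
  have h1 : ENNReal.ofReal |ξ j| < ENNReal.ofReal r := by
    refine lt_of_le_of_lt ?_ hr
    exact le_trans (le_iSup (fun j : Fin d => ENNReal.ofReal |ξ j|) j)
      (le_iSup₂ (f := fun ξ (_ : ξ ∈ dsupport (fourierTempered u)) =>
        ⨆ j : Fin d, ENNReal.ofReal |ξ j|) ξ hmem)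
  have h2 : |ξ j| < r := (ENNReal.ofReal_lt_ofReal_iff_of_nonneg (abs_nonneg _)).1 h1
  have hopen : IsOpen {ξ : V | |ξ j| < r} := isOpen_lt (by fun_prop) continuous_const
  refine (notMem_tsupport_iff_eventuallyEq.2 ?_) hξ
  exact (hopen.eventually_mem h2).mono fun y hy => hφ y hy

/-! ### Convolution with a kernel in one coordinate -/

theorem measurable_single_mul (j : Fin d) (c : ℝ) :
    Measurable fun t : ℝ => (EuclideanSpace.single j (c * t) : V) := by
  have h1 : (fun t : ℝ => (EuclideanSpace.single j (c * t) : V)) =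
      fun t : ℝ => (c * t) • (EuclideanSpace.single j 1 : V) := by
    funext t; ext i
    by_cases hi : i = j <;> simp [hi]
  rw [h1]
  exact (by fun_prop : Continuous _).measurable

theorem enorm_integral_translate_le {k : ℝ → ℂ} {h : V → ℂ} {a : ℝ → V} (x : V) :
    ‖∫ t, k t * h (x - a t)‖ₑ ≤ ∫⁻ t, ‖h (x - a t)‖ₑ * ‖k t‖ₑ := by
  refine (enorm_integral_le_lintegral_enorm _).trans_eq (lintegral_congr fun t => ?_)
  rw [enorm_mul, mul_comm]

theorem memLp_integral_translate {p : ℝ≥0∞} (hp : 1 ≤ p) {k : ℝ → ℂ} (hk : Measurable k)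
    (hki : Integrable k) {h : V → ℂ} (hc : Measurable h) (hh : MemLp h p volume) {a : ℝ → V}
    (ha : Measurable a) : MemLp (fun x => ∫ t, k t * h (x - a t)) p volume := by
  have hm : Measurable fun q : V × ℝ => k q.2 * h (q.1 - a q.2) :=
    (hk.comp measurable_snd).mul (hc.comp (measurable_fst.sub (ha.comp measurable_snd)))
  refine ⟨(hm.stronglyMeasurable.integral_prod_right').aestronglyMeasurable, ?_⟩
  refine lt_of_le_of_lt ((eLpNorm_mono_enorm fun x => ?_).trans
    (eLpNorm_lintegral_translate_le (μ := volume) hp (F := fun x => ‖h x‖ₑ) hc.enorm ha hk.enorm)) ?_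
  · exact enorm_integral_translate_le x
  · rw [eLpNorm_enorm]
    exact ENNReal.mul_lt_top hh.2 hki.2

theorem integrable_mul_translate_mul_translate {p q : ℝ≥0∞} [p.HolderConjugate q] {k : ℝ → ℂ}
    (hk : Measurable k) (hki : Integrable k) {h g : V → ℂ} (hc : Measurable h)
    (hh : MemLp h p volume) (gc : Measurable g) (hg : MemLp g q volume) {a b : ℝ → V}
    (ha : Measurable a) (hb : Measurable b) :
    Integrable (fun y : V × ℝ => k y.2 * (h (y.1 - a y.2) * g (y.1 - b y.2)))
      (volume.prod volume) := by
  have hm : Measurable fun y : V × ℝ => k y.2 * (h (y.1 - a y.2) * g (y.1 - b y.2)) :=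
    (hk.comp measurable_snd).mul
      ((hc.comp (measurable_fst.sub (ha.comp measurable_snd))).mul
        (gc.comp (measurable_fst.sub (hb.comp measurable_snd))))
  refine ⟨hm.aestronglyMeasurable, ?_⟩
  rw [HasFiniteIntegral, lintegral_prod_symm _ hm.enorm.aemeasurable]
  have hlt : ∫⁻ t, ‖k t‖ₑ * (eLpNorm h p volume * eLpNorm g q volume) < ⊤ := by
    rw [lintegral_mul_const _ hk.enorm]
    exact ENNReal.mul_lt_top hki.2 (ENNReal.mul_lt_top hh.2 hg.2)
  refine lt_of_le_of_lt (lintegral_mono fun t => ?_) hlt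
  have hmt : Measurable fun x => h (x - a t) := hc.comp (measurable_sub_const' (a t))
  have gmt : Measurable fun x => g (x - b t) := gc.comp (measurable_sub_const' (b t))
  have hprod : Measurable fun x => ‖h (x - a t)‖ₑ * ‖g (x - b t)‖ₑ := hmt.enorm.mul gmt.enorm
  have h1 := eLpNorm_comp_measurePreserving (p := p) hh.1 (measurePreserving_sub_right volume (a t))
  have h2 := eLpNorm_comp_measurePreserving (p := q) hg.1 (measurePreserving_sub_right volume (b t))
  calc ∫⁻ x, ‖k t * (h (x - a t) * g (x - b t))‖ₑ
      = ∫⁻ x, ‖k t‖ₑ * (‖h (x - a t)‖ₑ * ‖g (x - b t)‖ₑ) := by simp_rw [enorm_mul]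
    _ = ‖k t‖ₑ * ∫⁻ x, ‖h (x - a t)‖ₑ * ‖g (x - b t)‖ₑ := lintegral_const_mul _ hprod
    _ ≤ ‖k t‖ₑ * (eLpNorm (fun x => h (x - a t)) p volume *
          eLpNorm (fun x => g (x - b t)) q volume) := by
        gcongr
        exact lintegral_enorm_mul_le hmt.aestronglyMeasurable gmt.aestronglyMeasurable
    _ = _ := by rw [← h1, ← h2]; rfl

theorem integral_integral_translate_mul {p : ℝ≥0∞} (hp : 1 ≤ p) {k : ℝ → ℂ} (hk : Measurable k)
    (hki : Integrable k) {h : V → ℂ} (hc : Measurable h) (hh : MemLp h p volume) {a : ℝ → V}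
    (ha : Measurable a) (φ : 𝓢(V, ℂ)) :
    ∫ x, (∫ t, k t * h (x - a t)) * φ x = ∫ x, h x * ∫ t, k t * φ (x + a t) := by
  have := ENNReal.HolderConjugate.inv_one_sub_inv' hp
  have hφ := φ.memLp (1 - p⁻¹)⁻¹ (μ := volume)
  have i1 := integrable_mul_translate_mul_translate hk hki hc hh φ.continuous.measurable hφ ha
    (measurable_const (a := (0 : V)))
  have i2 := integrable_mul_translate_mul_translate hk hki hc hh φ.continuous.measurable hφ
    (measurable_const (a := (0 : V))) ha.neg
  simp only [sub_zero, Pi.neg_apply, sub_neg_eq_add] at i1 i2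
  calc _ = ∫ x, ∫ t, k t * (h (x - a t) * φ x) := by
        congr 1; funext x; rw [← integral_mul_const]; simp only [mul_assoc]
    _ = ∫ t, ∫ x, k t * (h (x - a t) * φ x) := integral_integral_swap i1
    _ = ∫ t, ∫ x, k t * (h x * φ (x + a t)) := by
        congr 1; funext t
        rw [← integral_add_right_eq_self _ (a t)]
        simp only [add_sub_cancel_right]
    _ = ∫ x, ∫ t, k t * (h x * φ (x + a t)) := (integral_integral_swap i2).symm
    _ = _ := by
        congr 1; funext x
        rw [← integral_const_mul]
        congr 1; funext t; ring

/-- A function whose spectrum lies in the slab `|ξ_j| < r`, where the cut-off function `χ` is `1`,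
has its `m`-th derivative in direction `j` reproduced by convolution with the Fourier transform of
`s ^ m * χ`. -/
theorem iterate_partialD_ae_eq_integral_translate {p : ℝ≥0∞} (hp : 1 ≤ p) {j : Fin d} {h : V → ℂ}
    (hs : ContDiff ℝ ∞ h) {m : ℕ} (hh : ∀ k ≤ m, MemLp ((partialD j)^[k] h) p volume) {r ρ A : ℝ}
    (hr : SpectrumIn j r h) {χ : ℝ → ℂ} (hχ : IsCutoff χ r ρ A)
    (hk : Integrable fun t : ℝ => fourierLaplace (fun s => (s : ℂ) ^ m * χ s) t) :
    ∀ᵐ x, (partialD j)^[m] h x = ∫ t : ℝ, fourierLaplace (fun s => (s : ℂ) ^ m * χ s) t *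
      h (x - EuclideanSpace.single j (2 * Real.pi * t)) := by
  set M : ℝ → ℂ := fun s => (s : ℂ) ^ m * χ s with hM
  have hMs : ContDiff ℝ ∞ M := (Complex.ofRealCLM.contDiff.pow m).mul hχ.contDiff
  have hMc : HasCompactSupport M := hχ.hasCompactSupport.mul_left
  have hkc := continuous_fourierLaplace_ofReal hMs.continuous hMc
  have ha := measurable_single_mul j (2 * Real.pi) (d := d)
  have hconv := memLp_integral_translate hp hkc.measurable hk hs.continuous.measurable
    (hh 0 (by omega)) ha
  -- both sides are compared on test functions, which are Fourier transforms of Schwartz functions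
  refine ae_eq_of_integral_contDiff_smul_eq ((hh m le_rfl).locallyIntegrable hp)
    (hconv.locallyIntegrable hp) fun g hg hgc => ?_
  have hgs : ContDiff ℝ ∞ fun x => (g x : ℂ) := Complex.ofRealCLM.contDiff.comp hg
  have hgcc : HasCompactSupport fun x => (g x : ℂ) := hgc.comp_left (g := Complex.ofReal) rfl
  obtain ⟨φ, hφ⟩ := exists_fourierSchwartz_eq (hgcc.toSchwartzMap hgs)
  have hgφ : ∀ x, (g x : ℂ) = fourierSchwartz d φ x := fun x => by rw [hφ]; rfl
  have e1 : ∫ x, g x • (partialD j)^[m] h x = ∫ x, (partialD j)^[m] h x * fourierSchwartz d φ x := by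
    congr 1; funext x; rw [Complex.real_smul, hgφ, mul_comm]
  have e2 : ∫ x, g x • (∫ t : ℝ, fourierLaplace M t *
      h (x - EuclideanSpace.single j (2 * Real.pi * t))) = ∫ x, (∫ t : ℝ, fourierLaplace M t *
      h (x - EuclideanSpace.single j (2 * Real.pi * t))) * fourierSchwartz d φ x := by
    congr 1; funext x; rw [Complex.real_smul, hgφ, mul_comm]
  rw [e1, e2, integral_iterate_partialD_mul_fourierSchwartz hp j hs hh,
    integral_integral_translate_mul hp hkc.measurable hk hs.continuous.measurable
      (hh 0 (by omega)) ha]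
  simp_rw [← fourierSchwartz_smulLeftCLM_comp_coord hMs hMc hk j φ]
  have hh0 : MemLp h p volume := hh 0 (by omega)
  rw [← sub_eq_zero, ← integral_sub (integrable_mul_schwartzMap hp hh0 _)
    (integrable_mul_schwartzMap hp hh0 _)]
  have hz := hr (SchwartzMap.smulLeftCLM ℂ (fun ξ : V => ((ξ j : ℝ) : ℂ) ^ m) φ -
    SchwartzMap.smulLeftCLM ℂ (fun ξ : V => M (ξ j)) φ) fun ξ hξ => by
      rw [sub_apply, SchwartzMap.smulLeftCLM_apply_apply (hasTemperateGrowth_coord_pow j m),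
        SchwartzMap.smulLeftCLM_apply_apply (hasTemperateGrowth_comp_coord hMs hMc j), hM]
      simp [hχ.eq_one _ hξ.le]
  rw [map_sub] at hz
  rw [← hz]
  congr 1; funext x
  rw [sub_apply, mul_sub]

end spectrum

/-! ### Multi-indices -/

section multiindex

variable {d : ℕ}

local notation "V" => EuclideanSpace ℝ (Fin d)

/-- Second derivatives are symmetric. -/
theorem partialD_comm (i j : Fin d) {f : V → ℂ} (hf : ContDiff ℝ ∞ f) :
    partialD i (partialD j f) = partialD j (partialD i f) := by
  have hd : Differentiable ℝ (fderiv ℝ f) :=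
    (hf.fderiv_right (m := ∞) (by simp)).differentiable (by simp)
  have key : ∀ (i j : Fin d) (x : V), partialD i (partialD j f) x =
      -fderiv ℝ (fderiv ℝ f) x (EuclideanSpace.single i 1) (EuclideanSpace.single j 1) := by
    intro i j x
    have h1 := ((hd x).hasFDerivAt.clm_apply
      (hasFDerivAt_const (EuclideanSpace.single j (1 : ℝ) : V) x)).const_mul (-Complex.I)
    have h2 : fderiv ℝ (partialD j f) x = _ := h1.fderiv
    rw [partialD, h2]
    simp only [smul_apply, ContinuousLinearMap.flip_apply, smul_eq_mul,
      ContinuousLinearMap.comp_zero, zero_add]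
    linear_combination fderiv ℝ (fderiv ℝ f) x (EuclideanSpace.single i 1)
      (EuclideanSpace.single j 1) * Complex.I_sq
  funext x
  rw [key, key, (hf.contDiffAt.isSymmSndFDerivAt
    (by simpa using WithTop.coe_le_coe.2 (le_top : (2 : ℕ∞) ≤ ⊤))).eq]

theorem partialD_iterate_comm (i j : Fin d) {f : V → ℂ} (hf : ContDiff ℝ ∞ f) (m : ℕ) :
    partialD i ((partialD j)^[m] f) = (partialD j)^[m] (partialD i f) := by
  induction m with
  | zero => rfl
  | succ m ih =>
    rw [Function.iterate_succ_apply', Function.iterate_succ_apply',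
      partialD_comm i j (contDiff_iterate_partialD j hf m), ih]

theorem contDiff_foldr_partialD (l : List (Fin d)) (α : Fin d → ℕ) {f : V → ℂ}
    (hf : ContDiff ℝ ∞ f) :
    ContDiff ℝ ∞ (l.foldr (fun j g => (partialD j)^[α j] g) f) := by
  induction l with
  | nil => exact hf
  | cons a l ih => exact contDiff_iterate_partialD a ih _

theorem contDiff_multiD (α : Fin d → ℕ) {f : V → ℂ} (hf : ContDiff ℝ ∞ f) :
    ContDiff ℝ ∞ (multiD α f) :=
  contDiff_foldr_partialD _ α hf

theorem foldr_partialD_add_single (l : List (Fin d)) (hl : l.Nodup) (α : Fin d → ℕ) (i : Fin d)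
    {f : V → ℂ} (hf : ContDiff ℝ ∞ f) :
    l.foldr (fun j g => (partialD j)^[(α + Pi.single i 1 : Fin d → ℕ) j] g) f =
      if i ∈ l then partialD i (l.foldr (fun j g => (partialD j)^[α j] g) f)
      else l.foldr (fun j g => (partialD j)^[α j] g) f := by
  induction l with
  | nil => simp
  | cons a l ih =>
    obtain ⟨hal, hl⟩ := List.nodup_cons.1 hl
    simp only [List.foldr_cons]
    rw [ih hl]
    rcases eq_or_ne a i with rfl | hai
    · rw [if_neg hal, if_pos (by simp), Pi.add_apply, Pi.single_eq_same,
        Function.iterate_succ_apply']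
    · have hc : (i ∈ a :: l) ↔ i ∈ l := by simp [hai.symm]
      simp only [hc, Pi.add_apply, Pi.single_eq_of_ne hai, add_zero]
      split_ifs
      · rw [partialD_iterate_comm i a (contDiff_foldr_partialD l α hf)]
      · rfl

theorem multiD_add_single (α : Fin d → ℕ) (i : Fin d) {f : V → ℂ} (hf : ContDiff ℝ ∞ f) :
    multiD (α + Pi.single i 1) f = partialD i (multiD α f) := by
  rw [multiD, foldr_partialD_add_single _ (List.nodup_finRange d) α i hf,
    if_pos (List.mem_finRange i)]
  rfl

theorem multiD_zero (f : V → ℂ) : multiD 0 f = f := by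
  have : ∀ l : List (Fin d), l.foldr (fun j g => (partialD j)^[(0 : Fin d → ℕ) j] g) f = f := by
    intro l
    induction l with
    | nil => rfl
    | cons a l ih => simp
  exact this _

theorem multiD_add_smul_single (α : Fin d → ℕ) (i : Fin d) (m : ℕ) {f : V → ℂ}
    (hf : ContDiff ℝ ∞ f) :
    multiD (α + m • Pi.single i 1) f = (partialD i)^[m] (multiD α f) := by
  induction m with
  | zero => simp
  | succ m ih =>
    rw [succ_nsmul, ← add_assoc, multiD_add_single _ _ hf, ih, Function.iterate_succ_apply']

theorem sum_add_smul_single (α : Fin d → ℕ) (i : Fin d) (m : ℕ) :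
    ∑ j, (α + m • Pi.single i 1 : Fin d → ℕ) j = ∑ j, α j + m := by
  simp [Finset.sum_add_distrib, Pi.single_apply]

theorem eq_zero_of_sum_eq_zero {α : Fin d → ℕ} (hα : ∑ i, α i = 0) : α = 0 :=
  funext fun i => Finset.sum_eq_zero_iff.1 hα i (Finset.mem_univ i)

theorem exists_eq_add_single {α : Fin d → ℕ} {n : ℕ} (hn : ∑ i, α i = n + 1) :
    ∃ (i : Fin d) (β : Fin d → ℕ), α = β + Pi.single i 1 ∧ ∑ k, β k = n := by
  obtain ⟨i, -, hi⟩ : ∃ i ∈ Finset.univ, α i ≠ 0 := by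
    by_contra! h
    rw [Finset.sum_eq_zero h] at hn
    omega
  have hα : α = α - Pi.single i 1 + Pi.single i 1 := by
    refine (tsub_add_cancel_of_le fun k => ?_).symm
    rcases eq_or_ne k i with rfl | hk
    · simpa using Nat.one_le_iff_ne_zero.2 hi
    · simp [hk]
  refine ⟨i, _, hα, ?_⟩
  have h := sum_add_smul_single (α - Pi.single i 1) i 1
  rw [one_smul, ← hα] at h
  omega

/-- The spectral slab of a function contains the spectrum of all its derivatives. -/
theorem SpectrumIn.multiD {p : ℝ≥0∞} (hp : 1 ≤ p) {j : Fin d} {r : ℝ} {f : V → ℂ}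
    (hr : SpectrumIn j r f) (hf : ContDiff ℝ ∞ f)
    (hh : ∀ α : Fin d → ℕ, MemLp (multiD α f) p volume) (α : Fin d → ℕ) :
    SpectrumIn j r (multiD α f) := by
  obtain ⟨n, hn⟩ : ∃ n, ∑ i, α i = n := ⟨_, rfl⟩
  induction n generalizing α with
  | zero =>
    rwa [eq_zero_of_sum_eq_zero hn, multiD_zero]
  | succ n ih =>
    obtain ⟨i, β, rfl, hs⟩ := exists_eq_add_single hn
    rw [multiD_add_single _ _ hf]
    refine (ih β hs).partialD hp (contDiff_multiD β hf) (hh β) ?_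
    rw [← multiD_add_single _ _ hf]
    exact hh _

end multiindex

/-! ### Weighted norms along blocks of derivatives -/

section upper

variable {d : ℕ}

local notation "V" => EuclideanSpace ℝ (Fin d)

theorem norm_div_succ_le_max {E : Type*} [SeminormedAddCommGroup E] (x y : E) {k : ℕ} (hk : 1 ≤ k) :
    ‖x‖ / (k + 1 : ℕ) ≤ max (‖x - y‖ / k) ‖y‖ := by
  have hk' : (0 : ℝ) < k := by exact_mod_cast hk
  set M := max (‖x - y‖ / k) ‖y‖ with hM
  have h1 : ‖x - y‖ ≤ M * k := (div_le_iff₀ hk').1 (le_max_left _ _)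
  have h2 : ‖y‖ ≤ M := le_max_right _ _
  have h3 : ‖x‖ ≤ ‖x - y‖ + ‖y‖ := norm_le_norm_sub_add x y
  rw [div_le_iff₀ (by positivity)]
  push_cast
  linarith

/-- Averaging translates by `a t` with a kernel `κ` costs the factor `∫ |κ|` if the dilation
parameter of the weight is increased by one, up to a term that sees the weight on `κ` only. -/
theorem eLpNorm_weight_integral_translate_le {p : ℝ≥0∞} (hp : 1 ≤ p) {g : ℝ → ℝ≥0∞}
    (hg : Monotone g) {k : ℕ} (hk : 1 ≤ k) {h H : V → ℂ} (hh : Measurable h) {κ : ℝ → ℂ}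
    (hκ : Measurable κ) {a : ℝ → V} (ha : Measurable a)
    (hH : ∀ᵐ x, H x = ∫ t, κ t * h (x - a t)) :
    eLpNorm (fun x => g (‖x‖ / (k + 1 : ℕ)) * ‖H x‖ₑ) p volume ≤
      eLpNorm (fun x => g (‖x‖ / k) * ‖h x‖ₑ) p volume * (∫⁻ t, ‖κ t‖ₑ) +
        eLpNorm h p volume * ∫⁻ t, g ‖a t‖ * ‖κ t‖ₑ := by
  have hgm := hg.measurable
  set F : V → ℝ≥0∞ := fun x => g (‖x‖ / k) * ‖h x‖ₑ with hF
  have hFm : Measurable F := (hgm.comp (by fun_prop)).mul hh.enorm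
  have hκ' : Measurable fun t => g ‖a t‖ * ‖κ t‖ₑ := (hgm.comp ha.norm).mul hκ.enorm
  have hsub : Measurable fun q : V × ℝ => q.1 - a q.2 :=
    measurable_fst.sub (ha.comp measurable_snd)
  have hm1 : Measurable fun x => ∫⁻ t, F (x - a t) * ‖κ t‖ₑ :=
    ((hFm.comp hsub).mul (hκ.enorm.comp measurable_snd)).lintegral_prod_right'
  have hm2 : Measurable fun x => ∫⁻ t, ‖h (x - a t)‖ₑ * (g ‖a t‖ * ‖κ t‖ₑ) :=
    ((hh.enorm.comp hsub).mul (hκ'.comp measurable_snd)).lintegral_prod_right'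
  calc _ ≤ eLpNorm ((fun x => ∫⁻ t, F (x - a t) * ‖κ t‖ₑ) +
        fun x => ∫⁻ t, ‖h (x - a t)‖ₑ * (g ‖a t‖ * ‖κ t‖ₑ)) p volume := by
        refine eLpNorm_mono_enorm_ae (hH.mono fun x hx => ?_)
        rw [enorm_eq_self, enorm_eq_self, hx]
        have hmt : Measurable fun t => F (x - a t) * ‖κ t‖ₑ :=
          (hFm.comp (measurable_const.sub ha)).mul hκ.enorm
        have hmt' : Measurable fun t => ‖h (x - a t)‖ₑ * ‖κ t‖ₑ :=
          (hh.comp (measurable_const.sub ha)).enorm.mul hκ.enorm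
        rw [Pi.add_apply, ← lintegral_add_left hmt]
        refine (mul_le_mul_right (enorm_integral_translate_le x) _).trans ?_
        rw [← lintegral_const_mul _ hmt']
        refine lintegral_mono fun t => ?_
        have h1 : g (‖x‖ / (k + 1 : ℕ)) ≤ g (‖x - a t‖ / k) + g ‖a t‖ := by
          refine (hg (norm_div_succ_le_max x (a t) hk)).trans ?_
          rw [hg.map_max]
          exact max_le le_self_add le_add_self
        calc _ ≤ (g (‖x - a t‖ / k) + g ‖a t‖) * (‖h (x - a t)‖ₑ * ‖κ t‖ₑ) := by gcongr
          _ = _ := by simp only [hF]; ring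
    _ ≤ _ := (eLpNorm_add_le hm1.aestronglyMeasurable hm2.aestronglyMeasurable hp).trans <|
        add_le_add (eLpNorm_lintegral_translate_le hp hFm ha hκ.enorm)
          ((eLpNorm_lintegral_translate_le hp hh.enorm ha hκ').trans_eq (by rw [eLpNorm_enorm]))

/-- A two-component recursion along blocks of `m` derivatives. The inhomogeneous term of `N` is
controlled by `U`, which grows geometrically, so that it contributes a factor linear in the number
of blocks and not exponential in it. -/
theorem le_pow_of_block_recursion {m : ℕ} {U : (Fin d → ℕ) → ℝ≥0∞}
    {N : ℕ → (Fin d → ℕ) → ℝ≥0∞} {B W : ℝ≥0∞}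
    (hU : ∀ β j, U (β + m • Pi.single j 1) ≤ U β * B)
    (hN : ∀ k β j, 1 ≤ k → N (k + 1) (β + m • Pi.single j 1) ≤ N k β * B + U β * (W * B))
    {s : ℕ} (hs : 1 ≤ s) (r q : Fin d → ℕ) :
    U (r + m • q) ≤ U r * B ^ (∑ j, q j) ∧
      N (s + ∑ j, q j) (r + m • q) ≤ (N s r + (∑ j, q j : ℕ) * (U r * W)) * B ^ (∑ j, q j) := by
  obtain ⟨n, hn⟩ : ∃ n, ∑ i, q i = n := ⟨_, rfl⟩
  rw [hn]
  induction n generalizing q with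
  | zero =>
    simp [eq_zero_of_sum_eq_zero hn]
  | succ n ih =>
    obtain ⟨j, q', rfl, hs'⟩ := exists_eq_add_single hn
    obtain ⟨ih1, ih2⟩ := ih q' hs'
    have e : r + m • (q' + Pi.single j 1) = r + m • q' + m • Pi.single j 1 := by
      rw [smul_add, add_assoc]
    rw [e]
    refine ⟨(hU _ j).trans ?_, (hN (s + n) _ j (by omega)).trans ?_⟩
    · rw [pow_succ, ← mul_assoc]; gcongr
    · calc _ ≤ (N s r + n * (U r * W)) * B ^ n * B + U r * B ^ n * (W * B) := by gcongr
        _ = _ := by push_cast; ring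

end upper

/-! ### Upper bounds -/

theorem eventually_mul_pow_le_pow {C r b : ℝ} (hr : 0 ≤ r) (hb : r < b) :
    ∀ᶠ n : ℕ in atTop, C * (n + 1) ^ 2 * r ^ n ≤ b ^ n := by
  rcases hr.eq_or_lt with rfl | hr
  · filter_upwards [eventually_ge_atTop 1] with n hn
    rw [zero_pow (by omega), mul_zero]
    exact pow_nonneg hb.le n
  have hb0 : 0 < b := hr.trans hb
  have hlim : Tendsto (fun n : ℕ => C * (b / r) *
      (((n + 1 : ℕ) : ℝ) ^ 2 * (r / b) ^ (n + 1))) atTop (𝓝 (C * (b / r) * 0)) := by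
    refine ((tendsto_pow_const_mul_const_pow_of_abs_lt_one 2 (r := r / b) ?_).comp
      (tendsto_add_atTop_nat 1)).const_mul _
    rw [abs_of_pos (by positivity), div_lt_one hb0]
    exact hb
  rw [mul_zero] at hlim
  filter_upwards [hlim.eventually (eventually_le_nhds zero_lt_one)] with n hn
  have h1 : C * (n + 1) ^ 2 * r ^ n = C * (b / r) *
      (((n + 1 : ℕ) : ℝ) ^ 2 * (r / b) ^ (n + 1)) * b ^ n := by
    push_cast
    rw [div_pow]
    field_simp
    ring
  rw [h1]
  exact mul_le_of_le_one_left (by positivity) hn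

section upper

variable {d : ℕ}

local notation "V" => EuclideanSpace ℝ (Fin d)

theorem lintegral_ofReal_mul_inv_one_add_sq {c : ℝ} (hc : 0 ≤ c) :
    ∫⁻ t : ℝ, ENNReal.ofReal (c * (1 + t ^ 2)⁻¹) = ENNReal.ofReal (c * Real.pi) := by
  rw [← ofReal_integral_eq_lintegral_ofReal (integrable_inv_one_add_sq.const_mul c)
    (Eventually.of_forall fun t => by positivity), integral_const_mul, integral_univ_inv_one_add_sq]

theorem IsCutoff.continuous_mul {χ : ℝ → ℂ} {r ρ A : ℝ} (hχ : IsCutoff χ r ρ A) {e : ℝ → ℂ}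
    (he : Continuous e) : Continuous fun t : ℝ => fourierLaplace (fun s => e s * χ s) t :=
  continuous_fourierLaplace_ofReal (he.mul hχ.contDiff.continuous) hχ.hasCompactSupport.mul_left

/-- For large `m` the kernels that reproduce `m`-th derivatives have mass at most `b ^ m`, for any
`b` larger than the radius of the spectrum, while the weight, truncated at any height, has a
uniformly bounded integral against them. -/
theorem exists_kernel {v : ℝ → ℝ} (hv : Monotone v) (hv0 : ∀ t, 0 ≤ v t)
    (hs : Summable fun k : ℕ => v (2 ^ k) / 2 ^ k) {r b : ℝ} (hr : 0 ≤ r) (hb : r < b) :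
    ∃ m : ℕ, 2 ≤ m ∧ ∃ W : ℝ≥0∞, W ≠ ⊤ ∧ ∀ K : ℕ, ∃ (χ : ℝ → ℂ) (ρ A : ℝ), IsCutoff χ r ρ A ∧
      ∫⁻ t : ℝ, ‖fourierLaplace (fun s => (s : ℂ) ^ m * χ s) t‖ₑ ≤ ENNReal.ofReal b ^ m ∧
      ∫⁻ t : ℝ, ENNReal.ofReal (Real.exp (v (min (2 * Real.pi * |t|) (2 ^ K)))) *
        ‖fourierLaplace (fun s => (s : ℂ) ^ m * χ s) t‖ₑ ≤ W := by
  obtain ⟨ρ, hrρ, hρb⟩ := exists_between hb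
  have hρ : 0 < ρ := hr.trans_lt hrρ
  have hb0 : 0 < b := hρ.trans hρb
  obtain ⟨A, W, hW⟩ := exists_isCutoff_weighted hv hv0 hs hr hrρ
  obtain ⟨C, hC, hCb⟩ := exists_fourierLaplace_pow_mul_le (e := fun s => (s : ℂ))
    Complex.ofRealCLM.contDiff (ρ := ρ) (r := ρ) A hρ.le hρ (fun s hs => by simpa using hs)
  obtain ⟨m, hm1, hm2⟩ := ((eventually_mul_pow_le_pow (C := C * Real.pi) hρ.le hρb).and
    (eventually_ge_atTop 2)).exists
  have hm : C * (m + 1) ^ 2 * ρ ^ m * Real.pi ≤ b ^ m := by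
    linarith
  refine ⟨m, hm2, ENNReal.ofReal (|W m| * Real.pi), ENNReal.ofReal_ne_top, fun K => ?_⟩
  obtain ⟨χ, hχ, hχW⟩ := hW K
  refine ⟨χ, ρ, A, hχ, ?_, ?_⟩
  · calc _ ≤ ∫⁻ t : ℝ, ENNReal.ofReal (C * (m + 1) ^ 2 * ρ ^ m * (1 + t ^ 2)⁻¹) := by
          refine lintegral_mono fun t => ?_
          rw [← ofReal_norm]
          exact ENNReal.ofReal_le_ofReal (hCb χ r hχ m t)
      _ = ENNReal.ofReal (C * (m + 1) ^ 2 * ρ ^ m * Real.pi) :=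
          lintegral_ofReal_mul_inv_one_add_sq (by positivity)
      _ ≤ ENNReal.ofReal b ^ m := by
          rw [← ENNReal.ofReal_pow hb0.le]
          exact ENNReal.ofReal_le_ofReal hm
  · rw [← lintegral_ofReal_mul_inv_one_add_sq (abs_nonneg _)]
    refine lintegral_mono fun t => ?_
    rw [← ofReal_norm, ← ENNReal.ofReal_mul (Real.exp_pos _).le]
    refine ENNReal.ofReal_le_ofReal ((hχW m t).trans ?_)
    gcongr
    exact le_abs_self _

theorem integrable_of_lintegral_enorm_le {κ : ℝ → ℂ} (hκ : Continuous κ) {c : ℝ≥0∞} (hc : c ≠ ⊤)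
    (h : ∫⁻ t, ‖κ t‖ₑ ≤ c) : Integrable κ :=
  ⟨hκ.aestronglyMeasurable, h.trans_lt hc.lt_top⟩

/-- The effect of a block of `m` derivatives in direction `j` on the plain and on the weighted
norms, in terms of the plain and the weighted mass of the reproducing kernel. -/
theorem eLpNorm_multiD_add_smul_single_le {p : ℝ≥0∞} (hp : 1 ≤ p) {f : V → ℂ}
    (hf : ContDiff ℝ ∞ f) (hh : ∀ α : Fin d → ℕ, MemLp (multiD α f) p volume) {r ρ A : ℝ} {χ : ℝ → ℂ}
    (hr : ∀ j, SpectrumIn j r f) (hχ : IsCutoff χ r ρ A) {m : ℕ} {B W : ℝ≥0∞} (hB : B ≠ ⊤)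
    (hχB : ∫⁻ t : ℝ, ‖fourierLaplace (fun s => (s : ℂ) ^ m * χ s) t‖ₑ ≤ B) {g : ℝ → ℝ≥0∞}
    (hg : Monotone g)
    (hχW : ∫⁻ t : ℝ, g (2 * Real.pi * |t|) * ‖fourierLaplace (fun s => (s : ℂ) ^ m * χ s) t‖ₑ ≤ W)
    (β : Fin d → ℕ) (j : Fin d) :
    eLpNorm (multiD (β + m • Pi.single j 1) f) p volume ≤ eLpNorm (multiD β f) p volume * B ∧
    ∀ k : ℕ, 1 ≤ k → eLpNorm (fun x => g (‖x‖ / (k + 1 : ℕ)) *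
        ‖multiD (β + m • Pi.single j 1) f x‖ₑ) p volume ≤
      eLpNorm (fun x => g (‖x‖ / k) * ‖multiD β f x‖ₑ) p volume * B +
        eLpNorm (multiD β f) p volume * W := by
  have hκ : Continuous fun t : ℝ => fourierLaplace (fun s => (s : ℂ) ^ m * χ s) t :=
    hχ.continuous_mul (Complex.continuous_ofReal.pow m)
  have hβ := contDiff_multiD β hf
  have hae := iterate_partialD_ae_eq_integral_translate hp hβ (j := j) (m := m)
    (fun k _ => by rw [← multiD_add_smul_single _ _ _ hf]; exact hh _)
    ((hr j).multiD hp hf hh β) hχ (integrable_of_lintegral_enorm_le hκ hB hχB)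
  rw [← multiD_add_smul_single _ _ _ hf] at hae
  have ha := measurable_single_mul j (2 * Real.pi) (d := d)
  constructor
  · calc _ ≤ eLpNorm (fun x => ∫⁻ t : ℝ,
          ‖multiD β f (x - EuclideanSpace.single j (2 * Real.pi * t))‖ₑ *
            ‖fourierLaplace (fun s => (s : ℂ) ^ m * χ s) t‖ₑ) p volume := by
          refine eLpNorm_mono_enorm_ae (hae.mono fun x hx => ?_)
          rw [hx, enorm_eq_self]
          exact enorm_integral_translate_le (a := fun t => EuclideanSpace.single j (2 * Real.pi * t)) x
      _ ≤ _ := eLpNorm_lintegral_translate_le hp hβ.continuous.measurable.enorm ha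
          hκ.measurable.enorm
      _ ≤ _ := by rw [eLpNorm_enorm]; gcongr
  · intro k hk
    refine (eLpNorm_weight_integral_translate_le hp hg hk hβ.continuous.measurable hκ.measurable ha
      hae).trans ?_
    have hn : ∀ t : ℝ, ‖(EuclideanSpace.single j (2 * Real.pi * t) : V)‖ = 2 * Real.pi * |t| := by
      intro t
      rw [PiLp.norm_single, Real.norm_eq_abs, abs_mul,
        abs_of_pos (by positivity : 0 < 2 * Real.pi)]
    simp only [hn]
    gcongr

theorem enorm_exp_mul (c : ℝ) (z : ℂ) :
    ‖(Real.exp c : ℂ) * z‖ₑ = ENNReal.ofReal (Real.exp c) * ‖z‖ₑ := by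
  rw [enorm_mul, ← ofReal_norm (Real.exp c : ℂ), Complex.norm_real, Real.norm_eq_abs, Real.abs_exp]

/-- The weighted norms of the derivatives of order `n` are bounded by `C (n + 1) b ^ n`, for any `b`
larger than the radius of the spectrum. -/
theorem eventually_eLpNorm_weighted_le {p : ℝ≥0∞} (hp : 1 ≤ p) {f : V → ℂ} (hf : ContDiff ℝ ∞ f)
    {v : ℝ → ℝ} (hv : Monotone v) (hv0 : ∀ t, 0 ≤ v t)
    (hs : Summable fun k : ℕ => v (2 ^ k) / 2 ^ k)
    (hh : ∀ α : Fin d → ℕ, MemLp (multiD α f) p volume)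
    (hhv : ∀ α : Fin d → ℕ, eLpNorm (fun x => ENNReal.ofReal
      (Real.exp (v (‖x‖ / ((∑ i, α i : ℕ) + 1 : ℝ)))) * ‖multiD α f x‖ₑ) p volume ≠ ⊤)
    {r b : ℝ} (hr0 : 0 ≤ r) (hb : r < b) (hr : ∀ j, SpectrumIn j r f) :
    ∃ C : ℝ≥0∞, C ≠ ⊤ ∧ ∀ᶠ n : ℕ in atTop, ∀ α : Fin d → ℕ, ∑ i, α i = n →
      eLpNorm (fun x => ENNReal.ofReal
        (Real.exp (v (‖x‖ / ((∑ i, α i : ℕ) + 1 : ℝ)))) * ‖multiD α f x‖ₑ) p volume ≤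
        C * (n + 1) * ENNReal.ofReal b ^ n := by
  obtain ⟨m, hm, W, hW, hker⟩ := exists_kernel hv hv0 hs hr0 hb
  have hb0 : 0 < b := hr0.trans_lt hb
  set b' := ENNReal.ofReal b with hb'
  have hb'0 : b' ≠ 0 := by simpa [hb'] using hb0
  have hb't : b' ≠ ⊤ := ENNReal.ofReal_ne_top
  set g : ℕ → ℝ → ℝ≥0∞ := fun K t => ENNReal.ofReal (Real.exp (v (min t (2 ^ K)))) with hg
  have hgm : ∀ K, Monotone (g K) := fun K s t hst => ENNReal.ofReal_le_ofReal
    (Real.exp_le_exp.2 (hv (min_le_min_right _ hst)))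
  set U : (Fin d → ℕ) → ℝ≥0∞ := fun β => eLpNorm (multiD β f) p volume with hU
  set N : ℕ → ℕ → (Fin d → ℕ) → ℝ≥0∞ := fun K k β =>
    eLpNorm (fun x => g K (‖x‖ / k) * ‖multiD β f x‖ₑ) p volume with hN
  -- the dilation parameter `s` at the start exceeds the order of any remainder modulo `m`
  set s := d * m + 1 with hsdef
  set S := Fintype.piFinset fun _ : Fin d => Finset.range m with hS
  have hsum_le : ∀ q ∈ S, ∑ i, q i ≤ d * m := by
    intro q hq
    calc ∑ i, q i ≤ ∑ _i : Fin d, m := Finset.sum_le_sum fun i _ =>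
          (Finset.mem_range.1 (Fintype.mem_piFinset.1 hq i)).le
      _ = d * m := by simp
  have hNle : ∀ K (q : Fin d → ℕ) (k : ℕ), ∑ i, q i + 1 ≤ k → N K k q ≤
      eLpNorm (fun x => ENNReal.ofReal
        (Real.exp (v (‖x‖ / ((∑ i, q i : ℕ) + 1 : ℝ)))) * ‖multiD q f x‖ₑ) p volume := by
    intro K q k hk
    refine eLpNorm_mono_enorm fun x => ?_
    rw [enorm_eq_self, enorm_eq_self]
    gcongr
    refine ENNReal.ofReal_le_ofReal (Real.exp_le_exp.2 (hv ((min_le_left _ _).trans ?_)))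
    have : ((∑ i, q i : ℕ) + 1 : ℝ) ≤ k := by exact_mod_cast hk
    gcongr
  set C₀ : ℝ≥0∞ := ∑ q ∈ S, (eLpNorm (fun x => ENNReal.ofReal
      (Real.exp (v (‖x‖ / ((∑ i, q i : ℕ) + 1 : ℝ)))) * ‖multiD q f x‖ₑ) p volume + U q) with hC₀
  have hC₀t : C₀ ≠ ⊤ := ENNReal.sum_ne_top.2 fun q _ =>
    ENNReal.add_ne_top.2 ⟨hhv q, (hh q).2.ne⟩
  have hC₀le : ∀ q ∈ S, eLpNorm (fun x => ENNReal.ofReal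
      (Real.exp (v (‖x‖ / ((∑ i, q i : ℕ) + 1 : ℝ)))) * ‖multiD q f x‖ₑ) p volume + U q ≤ C₀ :=
    fun q hq => Finset.single_le_sum (f := fun q => eLpNorm (fun x => ENNReal.ofReal
      (Real.exp (v (‖x‖ / ((∑ i, q i : ℕ) + 1 : ℝ)))) * ‖multiD q f x‖ₑ) p volume + U q)
      (fun _ _ => zero_le) hq
  set D : ℝ≥0∞ := ∑ i ∈ Finset.range s, (b' ^ i)⁻¹ with hD
  have hDt : D ≠ ⊤ := ENNReal.sum_ne_top.2 fun i _ => ENNReal.inv_ne_top.2 (pow_ne_zero i hb'0)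
  set W' := W / b' ^ m with hW'
  have hWB : W' * b' ^ m = W := ENNReal.div_mul_cancel (pow_ne_zero m hb'0) (ENNReal.pow_ne_top hb't)
  have hW't : W' ≠ ⊤ := ENNReal.div_ne_top hW (pow_ne_zero m hb'0)
  refine ⟨C₀ * (1 + W') * D, by finiteness, ?_⟩
  filter_upwards [eventually_ge_atTop (2 * (d * m))] with n hn α hα
  -- the truncated norms satisfy the bound, uniformly in the height of truncation
  have hbound : ∀ K, N K (n + 1) α ≤ C₀ * (1 + W') * D * (n + 1) * b' ^ n := by
    intro K
    obtain ⟨χ, ρ, A, hχ, hχB, hχW⟩ := hker K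
    -- `α` is a remainder `t` plus `∑ i, q i` blocks of `m` derivatives in one direction
    set t : Fin d → ℕ := fun i => α i % m with ht
    set q : Fin d → ℕ := fun i => α i / m with hq
    have htS : t ∈ S := Fintype.mem_piFinset.2 fun i =>
      Finset.mem_range.2 (Nat.mod_lt _ (by omega))
    have hα' : α = t + m • q := by
      funext i
      simp [ht, hq, Nat.mod_add_div]
    have hblock := eLpNorm_multiD_add_smul_single_le hp hf hh hr hχ
      (ENNReal.pow_ne_top hb't) hχB (hgm K) hχW
    obtain ⟨-, h2⟩ := le_pow_of_block_recursion (m := m) (U := U) (N := N K) (B := b' ^ m) (W := W')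
      (fun β j => (hblock β j).1)
      (fun k β j hk => by rw [hWB]; exact (hblock β j).2 k hk) (s := s) (by omega) t q
    rw [← hα'] at h2
    have hsumα : ∑ i, t i + m * ∑ i, q i = n := by
      rw [← hα, hα', Finset.mul_sum, ← Finset.sum_add_distrib]
      rfl
    set Q := ∑ i, q i with hQ
    have htle := hsum_le t htS
    have h2Q : 2 * Q ≤ m * Q := Nat.mul_le_mul_right _ hm
    have hcoef : N K s t + (Q : ℕ) * (U t * W') ≤ C₀ * (1 + W') * (n + 1) := by
      have e1 : N K s t ≤ C₀ := (hNle K t s (by omega)).trans (le_self_add.trans (hC₀le t htS))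
      have e2 : U t ≤ C₀ := le_add_self.trans (hC₀le t htS)
      have e3 : (Q : ℝ≥0∞) ≤ n := by exact_mod_cast (by omega : Q ≤ n)
      calc _ ≤ C₀ + n * (C₀ * W') := by gcongr
        _ ≤ C₀ + n * (C₀ * W') + (C₀ * n + C₀ * W') := le_self_add
        _ = _ := by ring
    have hpow : (b' ^ m) ^ Q ≤ D * b' ^ n := by
      have e1 : (b' ^ (∑ i, t i))⁻¹ ≤ D :=
        Finset.single_le_sum (f := fun i => (b' ^ i)⁻¹) (fun _ _ => zero_le)
          (Finset.mem_range.2 (by omega))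
      calc (b' ^ m) ^ Q = (b' ^ (∑ i, t i))⁻¹ * b' ^ n := by
            rw [← hsumα, pow_add, ← mul_assoc, ENNReal.inv_mul_cancel (pow_ne_zero _ hb'0)
              (ENNReal.pow_ne_top hb't), one_mul, pow_mul]
        _ ≤ _ := by gcongr
    -- as `m ≥ 2`, the dilation parameter `s + Q` after all blocks is at most `n + 1`
    calc N K (n + 1) α ≤ N K (s + Q) α := by
          refine eLpNorm_mono_enorm fun x => ?_
          rw [enorm_eq_self, enorm_eq_self]
          gcongr
          refine hgm K ?_
          have : ((s + Q : ℕ) : ℝ) ≤ (n + 1 : ℕ) := by exact_mod_cast (by omega : s + Q ≤ n + 1)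
          gcongr
      _ ≤ _ := h2
      _ ≤ C₀ * (1 + W') * (n + 1) * (D * b' ^ n) := by gcongr
      _ = _ := by ring
  -- the truncation is removed by Fatou's lemma
  have hcont := (contDiff_multiD α hf).continuous
  set F : ℕ → V → ℂ := fun K x => (Real.exp (v (min (‖x‖ / (n + 1 : ℕ)) (2 ^ K))) : ℂ) *
    multiD α f x with hF
  have hFe : ∀ K x, ‖F K x‖ₑ = g K (‖x‖ / (n + 1 : ℕ)) * ‖multiD α f x‖ₑ := by
    intro K x
    rw [hF, enorm_exp_mul]
  have hFm : ∀ K, AEStronglyMeasurable (F K) volume := by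
    intro K
    have e1 : Measurable fun x : V => Real.exp (v (min (‖x‖ / (n + 1 : ℕ)) (2 ^ K))) :=
      Real.measurable_exp.comp (hv.measurable.comp (by fun_prop))
    exact ((Complex.measurable_ofReal.comp e1).mul hcont.measurable).aestronglyMeasurable
  have hlim := Lp.eLpNorm_lim_le_liminf_eLpNorm (p := p) hFm
    (fun x => (Real.exp (v (‖x‖ / (n + 1 : ℕ))) : ℂ) * multiD α f x)
    (Eventually.of_forall fun x => by
      obtain ⟨K₀, hK₀⟩ := pow_unbounded_of_one_lt (‖x‖ / (n + 1 : ℕ)) one_lt_two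
      refine tendsto_const_nhds.congr' ?_
      filter_upwards [eventually_ge_atTop K₀] with K hK
      rw [hF]
      simp only
      rw [min_eq_left (hK₀.le.trans (pow_le_pow_right₀ one_le_two hK))])
  calc _ = eLpNorm (fun x => (Real.exp (v (‖x‖ / (n + 1 : ℕ))) : ℂ) * multiD α f x) p volume := by
        refine eLpNorm_congr_enorm_ae (Eventually.of_forall fun x => ?_)
        rw [enorm_eq_self, enorm_exp_mul, hα]
        push_cast
        rfl
    _ ≤ _ := hlim
    _ ≤ _ := by
        refine liminf_le_of_le (by isBoundedDefault) fun c hc => ?_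
        obtain ⟨K, hK⟩ := hc.exists
        refine hK.trans (le_trans (le_of_eq ?_) (hbound K))
        refine eLpNorm_congr_enorm_ae (Eventually.of_forall fun x => ?_)
        rw [enorm_eq_self, hFe]

end upper

/-! ### Lower bounds -/

section lower

variable {d : ℕ}

local notation "V" => EuclideanSpace ℝ (Fin d)

/-- A smooth function that inverts `s` near `s₀` and is bounded by `r⁻¹`, where `r < |s₀|`. -/
theorem exists_contDiff_mul_eq_one {s₀ r δ : ℝ} (hr : 0 < r) (hδ : 0 < δ) (hs : r + 2 * δ < |s₀|) :
    ∃ e : ℝ → ℂ, ContDiff ℝ ∞ e ∧ (∀ s, ‖e s‖ ≤ r⁻¹) ∧ ∀ s, |s - s₀| < δ → e s * s = 1 := by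
  let β : ContDiffBump s₀ := ⟨δ, 2 * δ, hδ, by linarith⟩
  have hfar : ∀ s, |s| ≤ r → β s = 0 := by
    intro s h
    refine β.zero_of_le_dist ?_
    rw [Real.dist_eq]
    have := abs_sub_abs_le_abs_sub s₀ s
    rw [abs_sub_comm] at this
    change 2 * δ ≤ _
    linarith
  refine ⟨fun s => ((β s / s : ℝ) : ℂ), Complex.ofRealCLM.contDiff.comp ?_, ?_, ?_⟩
  · refine contDiff_iff_contDiffAt.2 fun s => ?_
    rcases eq_or_ne s 0 with rfl | h0
    · refine (contDiffAt_const (c := (0 : ℝ))).congr_of_eventuallyEq ?_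
      filter_upwards [Metric.ball_mem_nhds (0 : ℝ) hr] with y hy
      rw [hfar y (by simpa using (mem_ball_zero_iff.1 hy).le)]
      exact zero_div y
    · exact β.contDiff.contDiffAt.div contDiffAt_id h0
  · intro s
    rw [Complex.norm_real, Real.norm_eq_abs, abs_div, abs_of_nonneg β.nonneg]
    rcases le_or_gt |s| r with h | h
    · rw [hfar s h, zero_div]; positivity
    · calc β s / |s| ≤ 1 / r := by
            gcongr
            exact β.le_one
        _ = r⁻¹ := one_div r
  · intro s h
    have h0 : s ≠ 0 := by
      rintro rfl
      rw [zero_sub, abs_neg] at h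
      linarith
    have h1 : β s = 1 := β.one_of_mem_closedBall (by
      rw [Metric.mem_closedBall, Real.dist_eq]; exact h.le)
    have h2 : (s : ℂ) ≠ 0 := by exact_mod_cast h0
    simp only [h1]
    push_cast
    field_simp

/-- If `M(ξ_j)` inverts `ξ_j ^ n` on the support of `φ`, then `f` tested against the Fourier
transform of `φ` is controlled by the `n`-th derivative of `f` and by the mass of the Fourier transform of
`M`. -/
theorem enorm_integral_mul_fourierSchwartz_le {p q : ℝ≥0∞} (hp : 1 ≤ p) [p.HolderConjugate q]
    {f : V → ℂ} (hf : ContDiff ℝ ∞ f) {j : Fin d} (hh : ∀ n : ℕ, MemLp ((partialD j)^[n] f) p volume)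
    {M : ℝ → ℂ} (hM : ContDiff ℝ ∞ M) (hMc : HasCompactSupport M) {c : ℝ≥0∞} (hc : c ≠ ⊤)
    (hk : ∫⁻ t : ℝ, ‖fourierLaplace M t‖ₑ ≤ c) {n : ℕ} (φ : 𝓢(V, ℂ))
    (hφ : ∀ ξ, φ ξ ≠ 0 → ((ξ j : ℝ) : ℂ) ^ n * M (ξ j) = 1) :
    ‖∫ x, f x * fourierSchwartz d φ x‖ₑ ≤
      eLpNorm ((partialD j)^[n] f) p volume * (eLpNorm (fourierSchwartz d φ) q volume * c) := by
  have hqp : q.HolderConjugate p := ENNReal.HolderConjugate.symm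
  have hq1 : 1 ≤ q := ENNReal.HolderConjugate.one_le q p
  have hkc := continuous_fourierLaplace_ofReal hM.continuous hMc
  have hki := integrable_of_lintegral_enorm_le hkc hc hk
  set φ' := SchwartzMap.smulLeftCLM ℂ (fun ξ : V => M (ξ j)) φ with hφ'
  have hφφ' : SchwartzMap.smulLeftCLM ℂ (fun ξ : V => ((ξ j : ℝ) : ℂ) ^ n) φ' = φ := by
    ext ξ
    rw [SchwartzMap.smulLeftCLM_apply_apply (hasTemperateGrowth_coord_pow j n), hφ',
      SchwartzMap.smulLeftCLM_apply_apply (hasTemperateGrowth_comp_coord hM hMc j), smul_smul]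
    by_cases hξ : φ ξ = 0
    · rw [hξ, smul_zero]
    · rw [hφ ξ hξ, one_smul]
  have ha := (measurable_single_mul j (2 * Real.pi) (d := d)).neg
  have hnorm : eLpNorm (fourierSchwartz d φ') q volume ≤
      eLpNorm (fourierSchwartz d φ) q volume * c := by
    calc _ ≤ eLpNorm (fun x => ∫⁻ t : ℝ,
          ‖fourierSchwartz d φ (x - -EuclideanSpace.single j (2 * Real.pi * t))‖ₑ *
          ‖fourierLaplace M t‖ₑ) q volume := by
          refine eLpNorm_mono_enorm fun x => ?_
          rw [hφ', fourierSchwartz_smulLeftCLM_comp_coord hM hMc hki, enorm_eq_self]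
          refine le_trans (le_of_eq ?_) (enorm_integral_translate_le
            (a := fun t => -EuclideanSpace.single j (2 * Real.pi * t)) x)
          simp only [sub_neg_eq_add]
      _ ≤ eLpNorm (fun x => ‖fourierSchwartz d φ x‖ₑ) q volume * ∫⁻ t : ℝ, ‖fourierLaplace M t‖ₑ :=
          eLpNorm_lintegral_translate_le hq1 (fourierSchwartz d φ).continuous.measurable.enorm ha
            hkc.measurable.enorm
      _ ≤ _ := by rw [eLpNorm_enorm]; gcongr
  calc ‖∫ x, f x * fourierSchwartz d φ x‖ₑ
      = ‖∫ x, (partialD j)^[n] f x * fourierSchwartz d φ' x‖ₑ := by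
        rw [integral_iterate_partialD_mul_fourierSchwartz hp j hf (fun k _ => hh k), hφφ']
    _ ≤ ∫⁻ x, ‖(partialD j)^[n] f x‖ₑ * ‖fourierSchwartz d φ' x‖ₑ := by
        refine (enorm_integral_le_lintegral_enorm _).trans_eq ?_
        simp_rw [enorm_mul]
    _ ≤ eLpNorm ((partialD j)^[n] f) p volume * eLpNorm (fourierSchwartz d φ') q volume :=
        lintegral_enorm_mul_le (hh n).1 (fourierSchwartz d φ').continuous.aestronglyMeasurable
    _ ≤ _ := by gcongr

/-- A point `ξ₀` of the spectrum forces the `n`-th derivatives in direction `j` to grow at least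
like `r ^ n`, for any `r < |ξ₀ j|`: the multiplier `ξ_j ^ n` can be inverted near `ξ₀`. -/
theorem exists_le_eLpNorm_iterate_partialD {p : ℝ≥0∞} (hp : 1 ≤ p) {f : V → ℂ}
    (hf : ContDiff ℝ ∞ f) {u : 𝓢'(V, ℂ)} (hu : IsDistributionOf u f) {j : Fin d}
    (hh : ∀ n : ℕ, MemLp ((partialD j)^[n] f) p volume) {ξ₀ : V}
    (hξ : ξ₀ ∈ dsupport (fourierTempered u)) {r : ℝ} (hr : 0 < r) (hr' : r < |ξ₀ j|) :
    ∃ c : ℝ, 0 < c ∧ ∀ n : ℕ, ENNReal.ofReal (c * r ^ n / (n + 1) ^ 2) ≤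
      eLpNorm ((partialD j)^[n] f) p volume := by
  set δ := (|ξ₀ j| - r) / 4 with hδ
  have hδ0 : 0 < δ := by rw [hδ]; linarith
  obtain ⟨e, he, hre, hes⟩ := exists_contDiff_mul_eq_one (s₀ := ξ₀ j) hr hδ0
    (by rw [hδ]; linarith)
  have hO : IsOpen {ξ : V | |ξ j - ξ₀ j| < δ} := isOpen_lt (by fun_prop) continuous_const
  obtain ⟨φ, hφs, hφ⟩ : ∃ φ : 𝓢(V, ℂ), tsupport φ ⊆ {ξ : V | |ξ j - ξ₀ j| < δ} ∧
      fourierTempered u φ ≠ 0 :=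
    (mem_dsupport_iff_forall_exists_ne ξ₀).1 hξ _ (by simpa using hδ0) hO
  obtain ⟨χ, A, hχ⟩ := exists_isCutoff (r := |ξ₀ j| + δ) (ρ := |ξ₀ j| + δ + 1) (by positivity)
    (by linarith)
  obtain ⟨C, hC, hCb⟩ := exists_fourierLaplace_pow_mul_le he (ρ := |ξ₀ j| + δ + 1) (r := r⁻¹) A
    (by positivity) (by positivity) (fun s _ => hre s)
  obtain ⟨q, _⟩ : ∃ q, p.HolderConjugate q := ⟨_, ENNReal.HolderConjugate.inv_one_sub_inv' hp⟩
  obtain ⟨G, hG⟩ : ∃ G, eLpNorm (fourierSchwartz d φ) q volume = G := ⟨_, rfl⟩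
  have hGt : G ≠ ⊤ := hG ▸ ((fourierSchwartz d φ).memLp q volume).eLpNorm_ne_top
  have main : ∀ n : ℕ, ‖fourierTempered u φ‖ₑ ≤ eLpNorm ((partialD j)^[n] f) p volume *
      (G * ENNReal.ofReal (C * (n + 1) ^ 2 * r⁻¹ ^ n * Real.pi)) := by
    intro n
    have hMs : ContDiff ℝ ∞ fun s => e s ^ n * χ s := (he.pow n).mul hχ.contDiff
    have hMc : HasCompactSupport fun s => e s ^ n * χ s := hχ.hasCompactSupport.mul_left
    have hk : ∫⁻ t : ℝ, ‖fourierLaplace (fun s => e s ^ n * χ s) t‖ₑ ≤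
        ENNReal.ofReal (C * (n + 1) ^ 2 * r⁻¹ ^ n * Real.pi) := by
      rw [← lintegral_ofReal_mul_inv_one_add_sq (by positivity)]
      refine lintegral_mono fun t => ?_
      rw [← ofReal_norm]
      exact ENNReal.ofReal_le_ofReal (hCb χ _ hχ n t)
    have h1 : fourierTempered u φ = ∫ x, f x * fourierSchwartz d φ x :=
      (hu _).2
    rw [h1, ← hG]
    refine enorm_integral_mul_fourierSchwartz_le hp hf hh hMs hMc ENNReal.ofReal_ne_top hk φ
      fun ξ hξ' => ?_
    have h2 : |ξ j - ξ₀ j| < δ := hφs (subset_tsupport φ hξ')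
    have h3 : |ξ j| ≤ |ξ₀ j| + δ := by
      have := abs_sub_abs_le_abs_sub (ξ j) (ξ₀ j)
      linarith
    rw [hχ.eq_one _ h3, mul_one, ← mul_pow, mul_comm, hes _ h2, one_pow]
  set c₀ := ‖fourierTempered u φ‖ with hc₀
  have hc₀0 : 0 < c₀ := norm_pos_iff.2 hφ
  set g := G.toReal * C * Real.pi + 1 with hg
  have hg0 : 0 < g := by positivity
  refine ⟨c₀ / g, by positivity, fun n => ?_⟩
  have hy : 0 < g * (n + 1) ^ 2 * r⁻¹ ^ n := by positivity
  have h1 : ENNReal.ofReal c₀ ≤ eLpNorm ((partialD j)^[n] f) p volume *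
      ENNReal.ofReal (g * (n + 1) ^ 2 * r⁻¹ ^ n) := by
    rw [hc₀, ofReal_norm]
    refine (main n).trans ?_
    gcongr
    rw [← ENNReal.ofReal_toReal hGt, ← ENNReal.ofReal_mul ENNReal.toReal_nonneg]
    refine ENNReal.ofReal_le_ofReal ?_
    calc G.toReal * (C * (n + 1) ^ 2 * r⁻¹ ^ n * Real.pi) =
          (G.toReal * C * Real.pi) * (n + 1) ^ 2 * r⁻¹ ^ n := by ring
      _ ≤ _ := by
          gcongr
          linarith
  have h2 : c₀ / g * r ^ n / (n + 1) ^ 2 = c₀ / (g * (n + 1) ^ 2 * r⁻¹ ^ n) := by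
    rw [inv_pow]
    field_simp
  rw [h2, ENNReal.ofReal_div_of_pos hy]
  exact ENNReal.div_le_of_le_mul h1

end lower

/-! ### Limits of `n`-th roots -/

theorem ENNReal.pow_rpow_one_div_natCast (x : ℝ≥0∞) {n : ℕ} (hn : n ≠ 0) :
    (x ^ n) ^ (1 / (n : ℝ)) = x := by
  rw [← ENNReal.rpow_natCast, ← ENNReal.rpow_mul, mul_one_div_cancel (by exact_mod_cast hn),
    ENNReal.rpow_one]

/-- Exponential bounds with polynomial losses determine the limit of the `n`-th roots. -/
theorem tendsto_rpow_one_div_of_bounds {a : ℕ → ℝ≥0∞} {R : ℝ≥0∞}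
    (hlow : ∀ r : ℝ, 0 < r → ENNReal.ofReal r < R → ∃ c : ℝ, 0 < c ∧
      ∀ n : ℕ, ENNReal.ofReal (c * r ^ n / (n + 1) ^ 2) ≤ a n)
    (hup : ∀ r b : ℝ, 0 ≤ r → r < b → R < ENNReal.ofReal r → ∃ C : ℝ, 0 ≤ C ∧
      ∀ᶠ n : ℕ in atTop, a n ≤ ENNReal.ofReal (C * (n + 1) * b ^ n)) :
    Tendsto (fun n : ℕ => a n ^ (1 / (n : ℝ))) atTop (𝓝 R) := by
  refine tendsto_order.2 ⟨fun L hL => ?_, fun L hL => ?_⟩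
  · obtain ⟨r₁, -, hLr, hr₁R⟩ := ENNReal.lt_iff_exists_real_btwn.1 hL
    obtain ⟨r₂, hr₂0, hr₁₂, hr₂R⟩ := ENNReal.lt_iff_exists_real_btwn.1 hr₁R
    have hr₁0 : 0 < r₁ := ENNReal.ofReal_pos.1 (zero_le.trans_lt hLr)
    have h12 : r₁ < r₂ := (ENNReal.ofReal_lt_ofReal_iff_of_nonneg hr₁0.le).1 hr₁₂
    obtain ⟨c, hc, hca⟩ := hlow r₂ (hr₁0.trans h12) hr₂R
    filter_upwards [eventually_mul_pow_le_pow (C := c⁻¹) hr₁0.le h12, eventually_ge_atTop 1]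
      with n hn hn1
    refine hLr.trans_le ?_
    rw [← ENNReal.pow_rpow_one_div_natCast (ENNReal.ofReal r₁) (n := n) (by omega)]
    gcongr
    refine le_trans ?_ (hca n)
    rw [← ENNReal.ofReal_pow hr₁0.le]
    refine ENNReal.ofReal_le_ofReal ?_
    rw [le_div_iff₀ (by positivity)]
    have := mul_le_mul_of_nonneg_left hn hc.le
    calc r₁ ^ n * (n + 1) ^ 2 = c * (c⁻¹ * (n + 1) ^ 2 * r₁ ^ n) := by field_simp
      _ ≤ _ := this
  · obtain ⟨b₂, hb₂0, hRb, hbL⟩ := ENNReal.lt_iff_exists_real_btwn.1 hL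
    obtain ⟨r, hr0, hRr, hrb⟩ := ENNReal.lt_iff_exists_real_btwn.1 hRb
    have h1 : r < b₂ := (ENNReal.ofReal_lt_ofReal_iff_of_nonneg hr0).1 hrb
    obtain ⟨b, hrb, hbb⟩ := exists_between h1
    obtain ⟨C, hC, hCa⟩ := hup r b hr0 hrb hRr
    have hb0 : 0 ≤ b := hr0.trans hrb.le
    filter_upwards [eventually_mul_pow_le_pow (C := C) hb0 hbb, hCa,
      eventually_ge_atTop 1] with n hn hna hn1
    refine lt_of_le_of_lt ?_ hbL
    rw [← ENNReal.pow_rpow_one_div_natCast (ENNReal.ofReal b₂) (n := n) (by omega)]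
    gcongr
    refine hna.trans ?_
    rw [← ENNReal.ofReal_pow hb₂0]
    refine ENNReal.ofReal_le_ofReal (le_trans ?_ hn)
    have : (n + 1 : ℝ) ≤ (n + 1) ^ 2 := by
      have : (0 : ℝ) ≤ n := n.cast_nonneg
      nlinarith
    gcongr

/-! ### Spectral radius formulas -/

section radius

variable {d : ℕ}

local notation "V" => EuclideanSpace ℝ (Fin d)

theorem exists_isDistributionOf {p : ℝ≥0∞} (hp : 1 ≤ p) {f : V → ℂ} (hf : MemLp f p volume) :
    ∃ u : 𝓢'(V, ℂ), IsDistributionOf u f := by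
  have : Fact (1 ≤ p) := ⟨hp⟩
  refine ⟨Lp.toTemperedDistribution (hf.toLp f), fun ψ => ⟨integrable_mul_schwartzMap hp hf ψ, ?_⟩⟩
  rw [Lp.toTemperedDistribution_apply]
  refine integral_congr_ae (hf.coeFn_toLp.mono fun x hx => ?_)
  simp only [hx, smul_eq_mul, mul_comm]

/-- The formula for the radius of the spectrum, for any family of numbers between the plain and the
weighted norms of the derivatives. -/
theorem tendsto_maxOrder_rpow_one_div {p : ℝ≥0∞} (hp : 1 ≤ p) {f : V → ℂ} (hf : ContDiff ℝ ∞ f)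
    {v : ℝ → ℝ} (hv : Monotone v) (hv0 : ∀ t, 0 ≤ v t)
    (hs : Summable fun k : ℕ => v (2 ^ k) / 2 ^ k)
    (hh : ∀ α : Fin d → ℕ, MemLp (multiD α f) p volume)
    (hhv : ∀ α : Fin d → ℕ, eLpNorm (fun x => ENNReal.ofReal
      (Real.exp (v (‖x‖ / ((∑ i, α i : ℕ) + 1 : ℝ)))) * ‖multiD α f x‖ₑ) p volume ≠ ⊤)
    {u : 𝓢'(V, ℂ)} (hu : IsDistributionOf u f) {a : (Fin d → ℕ) → ℝ≥0∞}
    (ha : ∀ α, eLpNorm (multiD α f) p volume ≤ a α)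
    (ha' : ∀ α, a α ≤ eLpNorm (fun x => ENNReal.ofReal
      (Real.exp (v (‖x‖ / ((∑ i, α i : ℕ) + 1 : ℝ)))) * ‖multiD α f x‖ₑ) p volume) :
    Tendsto (fun n : ℕ => maxOrder a n ^ (1 / (n : ℝ))) atTop
      (𝓝 (supportRadius (fourierTempered u))) := by
  refine tendsto_rpow_one_div_of_bounds (fun r hr hrR => ?_) (fun r b hr hb hRr => ?_)
  · simp only [supportRadius, lt_iSup_iff] at hrR
    obtain ⟨ξ, hξ, j, hj⟩ := hrR
    have hiter : ∀ n, multiD (n • Pi.single j 1) f = (partialD j)^[n] f := by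
      intro n
      have := multiD_add_smul_single 0 j n hf
      rwa [zero_add, multiD_zero] at this
    obtain ⟨c, hc, hcn⟩ := exists_le_eLpNorm_iterate_partialD hp hf hu (j := j)
      (fun n => by rw [← hiter]; exact hh _) hξ hr
      ((ENNReal.ofReal_lt_ofReal_iff_of_nonneg hr.le).1 hj)
    refine ⟨c, hc, fun n => (hcn n).trans ?_⟩
    rw [← hiter]
    refine (ha _).trans (Finset.le_sup (f := a) ?_)
    rw [Finset.mem_piAntidiag]
    have := sum_add_smul_single (0 : Fin d → ℕ) j n
    rw [zero_add] at this
    exact ⟨by simpa using this, fun i _ => Finset.mem_univ i⟩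
  · obtain ⟨C, hC, hCn⟩ := eventually_eLpNorm_weighted_le hp hf hv hv0 hs hh hhv hr hb
      fun j => spectrumIn_of_supportRadius_lt hu hRr j
    refine ⟨C.toReal, ENNReal.toReal_nonneg, hCn.mono fun n hn => Finset.sup_le fun α hα => ?_⟩
    refine (ha' α).trans ((hn α (Finset.mem_piAntidiag.1 hα).1).trans_eq ?_)
    have hb0 : 0 ≤ b := hr.trans hb.le
    rw [ENNReal.ofReal_mul (by positivity), ENNReal.ofReal_mul ENNReal.toReal_nonneg,
      ENNReal.ofReal_toReal hC, ENNReal.ofReal_pow hb0]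
    congr 2
    rw [ENNReal.ofReal_add (by positivity) zero_le_one]
    simp

end radius

theorem proposition3p3 {d : ℕ} (p : ℝ≥0∞) (hp : 1 ≤ p)
    (f : EuclideanSpace ℝ (Fin d) → ℂ) (hf : ContDiff ℝ ∞ f) :
    ((∀ α : Fin d → ℕ, MemLp (multiD α f) p volume) →
      ∃ u : 𝓢'(EuclideanSpace ℝ (Fin d), ℂ), IsDistributionOf u f ∧
        Tendsto (fun n : ℕ => maxOrder (fun α => eLpNorm (multiD α f) p volume) n ^ (1 / (n : ℝ)))
          atTop (𝓝 (supportRadius (fourierTempered u)))) ∧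
    (∀ w : ℝ → ℝ, IsWeightFunction w →
      ((∀ s t : ℝ, 0 ≤ s → 0 ≤ t → w (s + t) ≤ w s + w t) ∨
        (∃ H : ℝ, 1 < H ∧ ∀ t : ℝ, 0 ≤ t → 2 * w t ≤ w (H * t) + H)) →
      ∀ l : ℝ, 0 < l → (∀ α : Fin d → ℕ, MemLp (weightedD w l α f) p volume) →
      ∃ u : 𝓢'(EuclideanSpace ℝ (Fin d), ℂ), IsDistributionOf u f ∧
        ∀ μ : ℝ, 0 ≤ μ → μ ≤ l →
          Tendsto
            (fun n : ℕ => maxOrder (fun α => eLpNorm (weightedD w μ α f) p volume) n ^ (1 / (n : ℝ)))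
            atTop (𝓝 (supportRadius (fourierTempered u)))) := by
  refine ⟨fun hh => ?_, fun w hw _ l hl hh => ?_⟩
  · obtain ⟨u, hu⟩ := exists_isDistributionOf hp (by simpa only [multiD_zero] using hh 0)
    have hone : ∀ α : Fin d → ℕ, eLpNorm (fun x => ENNReal.ofReal (Real.exp 0) * ‖multiD α f x‖ₑ)
        p volume = eLpNorm (multiD α f) p volume := by
      intro α
      simp [eLpNorm_enorm]
    exact ⟨u, hu, tendsto_maxOrder_rpow_one_div hp hf (v := fun _ => 0) monotone_const
      (fun _ => le_rfl) (by simp) hh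
      (fun α => by rw [hone]; exact (hh α).2.ne) hu (fun _ => le_rfl) (fun α => (hone α).ge)⟩
  · have harg : ∀ (α : Fin d → ℕ) (x : EuclideanSpace ℝ (Fin d)),
        0 ≤ ‖x‖ / ((∑ i, α i : ℕ) + 1 : ℝ) := fun α x => by positivity
    have hexp : ∀ {μ : ℝ}, 0 ≤ μ → ∀ (α : Fin d → ℕ) (x : EuclideanSpace ℝ (Fin d)),
        1 ≤ ENNReal.ofReal (Real.exp (μ * w (‖x‖ / ((∑ i, α i : ℕ) + 1 : ℝ)))) := by
      intro μ hμ α x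
      rw [← ENNReal.ofReal_one]
      exact ENNReal.ofReal_le_ofReal
        (Real.one_le_exp (mul_nonneg hμ (hw.nonneg _ (harg α x))))
    have hle : ∀ {μ : ℝ}, 0 ≤ μ → ∀ α : Fin d → ℕ,
        eLpNorm (multiD α f) p volume ≤ eLpNorm (weightedD w μ α f) p volume := by
      intro μ hμ α
      refine eLpNorm_mono_enorm fun x => ?_
      rw [weightedD, enorm_exp_mul]
      exact le_mul_of_one_le_left' (hexp hμ α x)
    have hmem : ∀ α : Fin d → ℕ, MemLp (multiD α f) p volume := fun α =>
      ⟨(contDiff_multiD α hf).continuous.aestronglyMeasurable, (hle hl.le α).trans_lt (hh α).2⟩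
    obtain ⟨u, hu⟩ := exists_isDistributionOf hp (by simpa only [multiD_zero] using hmem 0)
    have hweight : ∀ α : Fin d → ℕ, eLpNorm (fun x => ENNReal.ofReal
        (Real.exp (l * w (max (‖x‖ / ((∑ i, α i : ℕ) + 1 : ℝ)) 0))) * ‖multiD α f x‖ₑ) p volume =
        eLpNorm (weightedD w l α f) p volume := by
      intro α
      refine eLpNorm_congr_enorm_ae (Eventually.of_forall fun x => ?_)
      rw [weightedD, enorm_exp_mul, enorm_eq_self, max_eq_left (harg α x)]
    have hsum : Summable fun k : ℕ => l * w (max (2 ^ k) 0) / 2 ^ k := by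
      refine ((summable_dyadic_of_integrableOn hw.monotoneOn hw.nonneg hw.integrable).mul_left
        l).congr fun k => ?_
      rw [max_eq_left (by positivity), mul_div_assoc]
    refine ⟨u, hu, fun μ hμ hμl => tendsto_maxOrder_rpow_one_div hp hf
      -- `w` is extended to negative arguments by `w 0`, where its own values are arbitrary
      (v := fun t => l * w (max t 0)) (fun s t hst => ?_) (fun t => ?_) hsum hmem
      (fun α => by rw [hweight]; exact (hh α).2.ne) hu (hle hμ) (fun α => ?_)⟩
    · exact mul_le_mul_of_nonneg_left (hw.monotoneOn (Set.mem_Ici.2 (le_max_right s 0))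
        (Set.mem_Ici.2 (le_max_right t 0)) (max_le_max_right 0 hst)) hl.le
    · exact mul_nonneg hl.le (hw.nonneg _ (le_max_right _ _))
    · rw [hweight]
      refine eLpNorm_mono_enorm fun x => ?_
      rw [weightedD, weightedD, enorm_exp_mul, enorm_exp_mul]
      gcongr
      exact hw.nonneg _ (harg α x)
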